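/- Let $\mathbb S_1=\{z\in\mathbb C:|z|=1\}$ with arc-length distance $d_R(z,w)=|\arg(z/w)|$ (where $\arg\in(-\pi,\pi]$). Put $\exp_c(x)=e^{ix}$ and let $\log_c(z)\in[0,2\pi)$ be the angle of $z$. Let $\mathcal W_2(\mathbb S_1)$ be the set of Borel probability measures on $\mathbb S_1$ (second moments are automatically finite) with the metric topology of $$W_2^2(\nu_1,\nu_2)=\inf_{\gamma}\int d_R(z,w)^2\,d\gamma(z,w),$$ the infimum being over all couplings $\gamma$ of $\nu_1$ and $\nu_2$. An optimal transport map from $\mu$ to $\nu$ is a Borel map $T:\mathbb S_1\to\mathbb S_1$ with $T\#\mu=\nu$ and $\int d_R(z,T(z))^2\,d\mu(z)=W_2^2(\mu,\nu)$. For a probability measure $\nu$ on $\mathbb S_1$ let $F_{\tilde\nu}(x)=\nu(\exp_c([0,x)))$ for $x\in[0,2\pi)$, extended to $\mathbb R$ by $F_{\tilde\nu}(x+2\pi)=F_{\tilde\nu}(x)+1$; let $F^\theta_{\tilde\nu}=F_{\tilde\nu}+\theta$, and let $G^-(u)=\inf\{x\in\mathbb R:G(x)\ge u\}$ denote the generalised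 inverse. Let $\mu$ be a probability measure on $\mathbb S_1$ that is absolutely continuous with respect to arc length. For each $\nu\in\mathcal W_2(\mathbb S_1)$ the function $$\theta\mapsto\int_0^1\big(F_{\tilde\mu}^-(u)-(F_{\tilde\nu}^{\theta})^-(u)\big)^2\,du,\qquad\theta\in\mathbb R,$$ has a unique minimiser $\theta^*=\theta^*(\nu)$, and, with $\widetilde T_\nu=(F_{\tilde\nu}^{\theta^*})^-\circ F_{\tilde\mu}$, the map $\exp_c\circ\widetilde T_\nu\circ\log_c$ is an optimal transport map from $\mu$ to $\nu$. Define $$\log_\mu:\mathcal W_2(\mathbb S_1)\to L^2_\mu(\mathbb S_1),\quad \log_\mu(\nu)=\widetilde T_\nu\circ\log_c,\qquad \exp_\mu:L^2_\mu(\mathbb S_1)\to\mathcal W_2(\mathbb S_1),\quad \exp_\mu(v)=(\exp_c\circ v)\#\mu .$$ Then: 1. For all $\nu_1,\nu_2\in\mathcal W_2(\mathbb S_1)$ and all optimal transport maps $T_\mu^{\nu_1},T_\mu^{\nu_2}$ from $\mu$ to $\nu_1$ and to $\nu_2$, $$W_2^2(\nu_1,\nu_2)\le\int_{\mathbb S_1}d_R^2\big(T_\mu^{\nu_1},T_\mu^{\nu_2}\big)\,d\mu\le\|\log_\mu(\nu_1)-\log_\mu(\nu_2)\|_{L^2_\mu}^2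 .$$ The map $\exp_\mu$ is continuous on $L^2_\mu(\mathbb S_1)$. 2. If $W_2(\nu,\nu_n)\to0$ in $\mathcal W_2(\mathbb S_1)$, then $\|\log_\mu(\nu_n)-\log_\mu(\nu)\|_{L^2_\mu}\to0$. 3. The map $\log_\mu$ is a homeomorphism from $\mathcal W_2(\mathbb S_1)$ onto its image $\log_\mu(\mathcal W_2(\mathbb S_1))\subset L^2_\mu(\mathbb S_1)$, and its inverse is the restriction of $\exp_\mu$ to that image. -/

import Mathlib

open MeasureTheory Filter Topology Set
open scoped ENNReal Real

noncomputable section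

namespace CircleOT

instance instMeasurableSpaceCircle : MeasurableSpace Circle := borel Circle

instance instBorelSpaceCircle : BorelSpace Circle := ⟨rfl⟩

/-- The universal covering `x ↦ e^{ix}` of the unit circle. -/
abbrev expC (x : ℝ) : Circle := Circle.exp x

/-- The angle of `z` in `[0, 2π)`. -/
def logC (z : Circle) : ℝ :=
  if 0 ≤ Complex.arg (z : ℂ) then Complex.arg (z : ℂ) else Complex.arg (z : ℂ) + 2 * π

/-- Arc-length (Riemannian) distance on the unit circle. -/
def arcDist (z w : Circle) : ℝ := |Complex.arg ((z / w : Circle) : ℂ)|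

/-- Arc-length measure on the unit circle. -/
def arcMeasure : Measure Circle := (volume.restrict (Ico (0 : ℝ) (2 * π))).map expC

/-! ### The Wasserstein space -/

/-- The 2-Wasserstein space of the circle: Borel probability measures with finite second moments. -/
@[ext]
structure W2Circle where
  /-- the underlying measure -/
  measure : Measure Circle
  isProb : IsProbabilityMeasure measure
  moment : ∀ z₀, ∫⁻ z, ENNReal.ofReal (arcDist z z₀ ^ 2) ∂measure < ∞

attribute [instance] W2Circle.isProb

/-- Couplings (transport plans) of two measures on the circle. -/
def couplings (μ ν : Measure Circle) : Set (Measure (Circle × Circle)) :=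
  {γ | γ.map Prod.fst = μ ∧ γ.map Prod.snd = ν}

/-- The Kantorovich cost `W₂²(μ, ν)`. -/
def transportCost (μ ν : Measure Circle) : ℝ≥0∞ :=
  ⨅ γ ∈ couplings μ ν, ∫⁻ p, ENNReal.ofReal (arcDist p.1 p.2 ^ 2) ∂γ

/-- The 2-Wasserstein distance. -/
def W2 (ν₁ ν₂ : W2Circle) : ℝ := √(transportCost ν₁.measure ν₂.measure).toReal

/-- The metric topology of `W2`: a set is open iff it contains a `W2`-ball around each of its
points. -/
instance instTopologicalSpaceW2Circle : TopologicalSpace W2Circle where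
  IsOpen U := ∀ ν ∈ U, ∃ ε > 0, ∀ ν', W2 ν' ν < ε → ν' ∈ U
  isOpen_univ := fun _ _ => ⟨1, one_pos, fun _ _ => mem_univ _⟩
  isOpen_inter := by
    rintro U V hU hV ν ⟨h1, h2⟩
    obtain ⟨a, ha, ha'⟩ := hU ν h1
    obtain ⟨b, hb, hb'⟩ := hV ν h2
    exact ⟨min a b, lt_min ha hb, fun ν' h =>
      ⟨ha' ν' (h.trans_le (min_le_left _ _)), hb' ν' (h.trans_le (min_le_right _ _))⟩⟩
  isOpen_sUnion := by
    rintro S hS ν ⟨U, hU, hν⟩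
    obtain ⟨a, ha, ha'⟩ := hS U hU ν hν
    exact ⟨a, ha, fun ν' h => ⟨U, hU, ha' ν' h⟩⟩

/-- `T` is an optimal transport map from `μ` to `ν`: the plan `(id, T)#μ` is a coupling of `μ` and
`ν` that attains the Kantorovich cost. -/
structure IsOptimalMap (μ ν : Measure Circle) (T : Circle → Circle) : Prop where
  measurable : Measurable T
  map_eq : μ.map T = ν
  cost_eq : ∫⁻ z, ENNReal.ofReal (arcDist z (T z) ^ 2) ∂μ = transportCost μ ν

/-! ### Periodic distribution functions, quantiles and the optimal shift -/

/-- The periodic distribution function: on `[0, 2π)` it is `x ↦ μ(exp_c([0, x)))`, and it is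
extended to the real line by `F (x + 2π) = F x + 1`. -/
def periodicCdf (μ : Measure Circle) (x : ℝ) : ℝ :=
  ⌊x / (2 * π)⌋ + μ.real {z | logC z < x - 2 * π * ⌊x / (2 * π)⌋}

/-- The vertical shift `F + θ` of the periodic distribution function. -/
def shiftedCdf (θ : ℝ) (μ : Measure Circle) (x : ℝ) : ℝ := periodicCdf μ x + θ

/-- Generalised inverse of a nondecreasing function. -/
def quantile (G : ℝ → ℝ) (u : ℝ) : ℝ := sInf {x | u ≤ G x}

/-- The cost of transporting the quantiles of `μ` to those of `ν` shifted by `θ`. -/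
def shiftCost (μ ν : Measure Circle) (θ : ℝ) : ℝ :=
  ∫ u in (0 : ℝ)..1, (quantile (periodicCdf μ) u - quantile (shiftedCdf θ ν) u) ^ 2

/-- The minimiser `θ*` of `shiftCost μ ν` over the real line. -/
def optShift (μ ν : Measure Circle) : ℝ :=
  Classical.epsilon fun θ => ∀ θ', shiftCost μ ν θ ≤ shiftCost μ ν θ'

/-- The lifted map `(F_ν + θ*)⁻ ∘ F_μ` on the real line. -/
def liftMap (μ ν : Measure Circle) (x : ℝ) : ℝ :=
  quantile (shiftedCdf (optShift μ ν) ν) (periodicCdf μ x)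

/-! ### Helper facts -/

lemma logC_mem (z : Circle) : logC z ∈ Ico 0 (2 * π) := by
  have h1 := Complex.neg_pi_lt_arg (z : ℂ)
  have h2 := Complex.arg_le_pi (z : ℂ)
  have h3 := Real.pi_pos
  unfold logC
  split_ifs with h
  · exact ⟨h, by linarith⟩
  · exact ⟨by linarith, by linarith⟩

lemma expC_logC (z : Circle) : expC (logC z) = z := by
  unfold logC
  split_ifs with h
  · exact Circle.exp_arg z
  · exact (Circle.exp_add_two_pi _).trans (Circle.exp_arg z)

lemma measurable_logC : Measurable logC := by
  have hc : Continuous fun z : Circle => (z : ℂ) := continuous_subtype_val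
  have h : Measurable fun z : Circle => Complex.arg (z : ℂ) :=
    Complex.measurable_arg.comp hc.measurable
  exact Measurable.ite (measurableSet_le measurable_const h) h (h.add_const _)

lemma arcDist_le_pi (z w : Circle) : arcDist z w ≤ π := Complex.abs_arg_le_pi _

lemma lintegral_arcDist_sq_lt_top (ρ : Measure Circle) [IsProbabilityMeasure ρ] (z₀ : Circle) :
    ∫⁻ z, ENNReal.ofReal (arcDist z z₀ ^ 2) ∂ρ < ∞ := by
  refine lt_of_le_of_lt (lintegral_mono (g := fun _ => ENNReal.ofReal (π ^ 2)) fun z => ?_) ?_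
  · exact ENNReal.ofReal_le_ofReal
      (pow_le_pow_left₀ (abs_nonneg _) (arcDist_le_pi z z₀) 2)
  · simp

lemma periodicCdf_bounds (μ : Measure Circle) [IsProbabilityMeasure μ] (x : ℝ) :
    x / (2 * π) - 1 ≤ periodicCdf μ x ∧ periodicCdf μ x ≤ x / (2 * π) + 1 := by
  have h1 := Int.sub_one_lt_floor (x / (2 * π))
  have h2 := Int.floor_le (x / (2 * π))
  have h3 : μ.real {z | logC z < x - 2 * π * ⌊x / (2 * π)⌋} ≤ 1 := measureReal_le_one
  have h4 : 0 ≤ μ.real {z | logC z < x - 2 * π * ⌊x / (2 * π)⌋} := measureReal_nonneg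
  unfold periodicCdf
  exact ⟨by linarith, by linarith⟩

lemma periodicCdf_mono (μ : Measure Circle) [IsProbabilityMeasure μ] :
    Monotone (periodicCdf μ) := by
  intro x y hxy
  have hfl : ⌊x / (2 * π)⌋ ≤ ⌊y / (2 * π)⌋ := Int.floor_mono (by gcongr)
  unfold periodicCdf
  rcases hfl.eq_or_lt with h | h
  · rw [h]
    have h6 : {z | logC z < x - 2 * π * ⌊y / (2 * π)⌋} ⊆ {z | logC z < y - 2 * π * ⌊y / (2 * π)⌋} :=
      fun z (hz : logC z < _) => (show logC z < _ by linarith)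
    have h7 := measureReal_mono (μ := μ) h6
    linarith
  · have h3 : μ.real {z | logC z < x - 2 * π * ⌊x / (2 * π)⌋} ≤ 1 := measureReal_le_one
    have h4 : 0 ≤ μ.real {z | logC z < y - 2 * π * ⌊y / (2 * π)⌋} := measureReal_nonneg
    have h5 : (⌊x / (2 * π)⌋ : ℝ) + 1 ≤ ⌊y / (2 * π)⌋ := by exact_mod_cast h
    linarith

lemma quantile_shiftedCdf_mono (θ : ℝ) (ν : Measure Circle) [IsProbabilityMeasure ν] :
    Monotone (quantile (shiftedCdf θ ν)) := by
  intro u v huv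
  have hp : 0 < 2 * π := Real.two_pi_pos
  refine csInf_le_csInf ⟨(u - θ - 1) * (2 * π), ?_⟩ ⟨(v - θ + 1) * (2 * π), ?_⟩ ?_
  · intro x hx
    have h1 := (periodicCdf_bounds ν x).2
    simp only [mem_ofPred_eq, shiftedCdf] at hx
    exact (le_div_iff₀ hp).1 (by linarith)
  · have h1 := (periodicCdf_bounds ν ((v - θ + 1) * (2 * π))).1
    rw [mul_div_cancel_right₀ _ hp.ne'] at h1
    simp only [mem_ofPred_eq, shiftedCdf]
    linarith
  · intro x hx
    exact huv.trans hx

lemma liftMap_mono (μ ν : Measure Circle) [IsProbabilityMeasure μ] [IsProbabilityMeasure ν] :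
    Monotone (liftMap μ ν) :=
  (quantile_shiftedCdf_mono _ ν).comp (periodicCdf_mono μ)

lemma measurable_liftMap_logC (μ ν : Measure Circle) [IsProbabilityMeasure μ]
    [IsProbabilityMeasure ν] : Measurable fun z => liftMap μ ν (logC z) :=
  (liftMap_mono μ ν).measurable.comp measurable_logC

lemma memLp_liftMap_logC (μ ν : Measure Circle) [IsProbabilityMeasure μ]
    [IsProbabilityMeasure ν] : MemLp (fun z => liftMap μ ν (logC z)) 2 μ := by
  refine MemLp.of_bound (measurable_liftMap_logC μ ν).aestronglyMeasurable
    (max |liftMap μ ν 0| |liftMap μ ν (2 * π)|) (ae_of_all _ fun z => ?_)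
  exact abs_le_max_abs_abs (liftMap_mono μ ν (logC_mem z).1) (liftMap_mono μ ν (logC_mem z).2.le)

/-! ### Exponential and logarithmic maps at `μ` -/

/-- The logarithmic map at `μ`: the class in `L²(μ)` of `(F_ν + θ*)⁻ ∘ F_μ`, read as a function on
the circle through `logC`. -/
def logMap (μ : Measure Circle) [IsProbabilityMeasure μ] (ν : W2Circle) : Lp ℝ 2 μ :=
  (memLp_liftMap_logC μ ν.measure).toLp

/-- The exponential map at `μ`: `v ↦ (exp_c ∘ v)#μ`. -/
def expMap (μ : Measure Circle) [IsProbabilityMeasure μ] (v : Lp ℝ 2 μ) : W2Circle :=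
  have hp : IsProbabilityMeasure (μ.map fun z => expC (v z)) :=
    Measure.isProbabilityMeasure_map
      (Circle.exp.continuous.measurable.comp_aemeasurable (Lp.aestronglyMeasurable v).aemeasurable)
  { measure := μ.map fun z => expC (v z)
    isProb := hp
    moment := lintegral_arcDist_sq_lt_top _ }

end CircleOT

end

namespace CircleOT

/-! ### Arc-length distance -/

/-! Everything rests on a Kantorovich dual certificate for the lifted map, obtained by working with
periodic functions on the line. Write `F` for the periodic distribution function of `μ` and `Q` for
the quantile function of `ν`. If `S` is monotone, `S (x + 2π) = S x + 2π`, and `s - S s` has zero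
mean over a period, then its primitive φ is 2π-periodic, and so is the conjugate κ for the cost `(x
- y)² / 2`. Both descend to the circle, and φ(x) + κ(y) equals the cost exactly when `y` lies
between the one-sided limits of `S` at `x`. The zero-mean condition selects θ*
(`exists_isDualPair`): with `S` essentially `Q (F - θ)`, θ is chosen so that the mean vanishes.

Absolute continuity of `μ` enters only through the absence of atoms. Then `F` is continuous and `F ∘
logC` is uniform on `(0, 1)`, so almost every point avoids the countably many jumps of `Q` and the
contact point `y` is unique there. Integrating the certificate shows that θ is a minimiser and that
the lifted map is optimal. Equality in the integrated inequality forces equality almost everywhere,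
which gives uniqueness of θ and of optimal maps.

For stability, the lifted map to `ν_n` is inserted in the certificate of `ν`. Its defect, cost minus
potentials, is nonnegative with integral at most `4π W2 ν ν_n` (`integral_defect_le`). Along a
subsequence the defect tends to zero almost everywhere. Lifts stay within π of the starting angle
and the defect has a unique zero, so compactness gives pointwise convergence, and dominated
convergence gives L². In the other direction `expMap` is 1-Lipschitz, because the covering map does
not increase distances. -/

lemma arcDist_nonneg (z w : Circle) : 0 ≤ arcDist z w := abs_nonneg _

lemma arcDist_comm (z w : Circle) : arcDist z w = arcDist w z := by
  unfold arcDist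
  rw [← Complex.abs_arg_inv, ← Circle.coe_inv, inv_div]

lemma arcDist_expC_le (a b : ℝ) : arcDist (expC a) (expC b) ≤ |a - b| := by
  rcases lt_or_ge |a - b| π with h | h
  · unfold arcDist
    rw [← Circle.exp_sub, Circle.arg_exp (abs_lt.1 h).1 (abs_lt.1 h).2.le]
  · exact (arcDist_le_pi _ _).trans h

lemma arcDist_logC_le (z w : Circle) (b : ℝ) (hb : expC b = w) :
    arcDist z w ≤ |logC z - b| := by
  have h := arcDist_expC_le (logC z) b
  rwa [expC_logC, hb] at h

/-- Among the lifts of `w`, the nearest one to `x` realises the arc distance. This transfers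
inequalities from the line to the circle. -/
lemma exists_expC_eq_abs_sub_eq_arcDist (x : ℝ) (w : Circle) :
    ∃ y, expC y = w ∧ |x - y| = arcDist (expC x) w := by
  refine ⟨x - Complex.arg ((expC x / w : Circle) : ℂ), ?_, ?_⟩
  · simp only [expC]
    rw [Circle.exp_sub, Circle.exp_arg]
    simp
  · rw [sub_sub_cancel]; rfl

lemma measurable_arcDist : Measurable fun p : Circle × Circle => arcDist p.1 p.2 := by
  have hc : Continuous fun z : Circle => (z : ℂ) := continuous_subtype_val
  have hd : Continuous fun p : Circle × Circle => p.1 / p.2 := continuous_fst.div' continuous_snd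
  exact (Complex.measurable_arg.comp (hc.comp hd).measurable).abs

lemma measurable_expC : Measurable expC := Circle.exp.continuous.measurable

lemma expC_periodic : Function.Periodic expC (2 * π) := Circle.exp_add_two_pi

/-! ### The periodic distribution function and its quantiles -/

lemma periodicCdf_add_two_pi (ν : Measure Circle) (x : ℝ) :
    periodicCdf ν (x + 2 * π) = periodicCdf ν x + 1 := by
  have h : ⌊(x + 2 * π) / (2 * π)⌋ = ⌊x / (2 * π)⌋ + 1 := by
    rw [add_div, div_self Real.two_pi_pos.ne', Int.floor_add_one]
  unfold periodicCdf
  rw [h]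
  push_cast
  rw [show x + 2 * π - 2 * π * ((⌊x / (2 * π)⌋ : ℝ) + 1) = x - 2 * π * ⌊x / (2 * π)⌋ by ring]
  ring

lemma periodicCdf_of_mem (ν : Measure Circle) {x : ℝ} (hx : x ∈ Ico 0 (2 * π)) :
    periodicCdf ν x = ν.real {z | logC z < x} := by
  have h : ⌊x / (2 * π)⌋ = 0 := by
    rw [Int.floor_eq_zero_iff]
    exact ⟨div_nonneg hx.1 Real.two_pi_pos.le, (div_lt_one Real.two_pi_pos).2 hx.2⟩
  simp [periodicCdf, h]

lemma periodicCdf_zero (ν : Measure Circle) : periodicCdf ν 0 = 0 := by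
  rw [periodicCdf_of_mem ν ⟨le_rfl, Real.two_pi_pos⟩]
  have : {z | logC z < 0} = ∅ := by
    ext z; simpa using (logC_mem z).1
  simp [this]

lemma periodicCdf_two_pi (ν : Measure Circle) : periodicCdf ν (2 * π) = 1 := by
  have h := periodicCdf_add_two_pi ν 0
  rwa [zero_add, periodicCdf_zero, zero_add] at h

lemma periodicCdf_of_mem_Icc (ν : Measure Circle) [IsProbabilityMeasure ν] {x : ℝ}
    (hx : x ∈ Icc 0 (2 * π)) : periodicCdf ν x = ν.real {z | logC z < x} := by
  rcases hx.2.lt_or_eq with h | rfl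
  · exact periodicCdf_of_mem ν ⟨hx.1, h⟩
  · have : {z | logC z < 2 * π} = univ := by
      ext z; simpa using (logC_mem z).2
    simp [this, periodicCdf_two_pi]

/-- The strict form is the usable one: the distribution function is defined with half-open arcs `[0,
x)` and need not be right-continuous, so the infimum defining the quantile need not be attained. -/
lemma quantile_lt_iff (ν : Measure Circle) [IsProbabilityMeasure ν] (u x : ℝ) :
    quantile (periodicCdf ν) u < x ↔ ∃ y < x, u ≤ periodicCdf ν y := by
  have hp : 0 < 2 * π := Real.two_pi_pos
  have hb : BddBelow {x | u ≤ periodicCdf ν x} := by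
    refine ⟨(u - 1) * (2 * π), fun x hx => ?_⟩
    have h1 := (periodicCdf_bounds ν x).2
    simp only [mem_ofPred_eq] at hx
    exact (le_div_iff₀ hp).1 (by linarith)
  have hn : {x | u ≤ periodicCdf ν x}.Nonempty := by
    refine ⟨(u + 1) * (2 * π), ?_⟩
    have h1 := (periodicCdf_bounds ν ((u + 1) * (2 * π))).1
    rw [mul_div_cancel_right₀ _ hp.ne'] at h1
    simp only [mem_ofPred_eq]
    linarith
  unfold quantile
  rw [csInf_lt_iff hb hn]
  exact ⟨fun ⟨y, h1, h2⟩ => ⟨y, h2, h1⟩, fun ⟨y, h1, h2⟩ => ⟨y, h2, h1⟩⟩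

lemma quantile_shiftedCdf (θ : ℝ) (ν : Measure Circle) (u : ℝ) :
    quantile (shiftedCdf θ ν) u = quantile (periodicCdf ν) (u - θ) := by
  unfold quantile shiftedCdf
  simp only [sub_le_iff_le_add]

lemma quantile_add_one (ν : Measure Circle) [IsProbabilityMeasure ν] (u : ℝ) :
    quantile (periodicCdf ν) (u + 1) = quantile (periodicCdf ν) u + 2 * π := by
  refine eq_of_forall_gt_iff fun x => ?_
  rw [← lt_sub_iff_add_lt, quantile_lt_iff, quantile_lt_iff]
  constructor
  · rintro ⟨y, hy, hu⟩
    refine ⟨y - 2 * π, by linarith, ?_⟩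
    have := periodicCdf_add_two_pi ν (y - 2 * π)
    rw [sub_add_cancel] at this
    linarith
  · rintro ⟨y, hy, hu⟩
    refine ⟨y + 2 * π, by linarith, ?_⟩
    rw [periodicCdf_add_two_pi]
    linarith

lemma quantile_mono (ν : Measure Circle) [IsProbabilityMeasure ν] :
    Monotone (quantile (periodicCdf ν)) := by
  have h := quantile_shiftedCdf_mono 0 ν
  intro u v huv
  have := h huv
  simpa [quantile_shiftedCdf] using this

lemma measurable_quantile (ν : Measure Circle) [IsProbabilityMeasure ν] :
    Measurable (quantile (periodicCdf ν)) := (quantile_mono ν).measurable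

/-- Left continuity of the distribution function, from continuity of the measure along increasing
sets. -/
lemma exists_lt_le_periodicCdf (ν : Measure Circle) [IsProbabilityMeasure ν] {x u : ℝ}
    (hx : x ∈ Ioc 0 (2 * π)) (hu : u < ν.real {z | logC z < x}) :
    ∃ y < x, u ≤ periodicCdf ν y := by
  obtain ⟨a, ha, hax, hlim⟩ := exists_seq_strictMono_tendsto x
  have hU : {z | logC z < x} = ⋃ n, {z | logC z < a n} := by
    ext z
    simp only [mem_ofPred_eq, mem_iUnion]
    refine ⟨fun h => ((tendsto_order.1 hlim).1 _ h).exists, fun ⟨n, hn⟩ => hn.trans (hax n)⟩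
  have hm : Monotone fun n => {z | logC z < a n} :=
    fun i j hij z (hz : logC z < a i) => hz.trans_le (ha.monotone hij)
  have ht := tendsto_measure_iUnion_atTop (μ := ν) hm
  rw [← hU] at ht
  have ht' := (ENNReal.tendsto_toReal (measure_ne_top ν {z | logC z < x})).comp ht
  obtain ⟨n, hn, hn0⟩ := (((tendsto_order.1 ht').1 _ hu).and
    ((tendsto_order.1 hlim).1 _ hx.1)).exists
  refine ⟨a n, hax n, ?_⟩
  rw [periodicCdf_of_mem ν ⟨hn0.le, (hax n).trans_le hx.2⟩]
  exact hn.le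

/-- The quantile function pushes the uniform distribution to the law of the angle. -/
lemma map_quantile (ν : Measure Circle) [IsProbabilityMeasure ν] :
    (volume.restrict (Ioo (0 : ℝ) 1)).map (quantile (periodicCdf ν)) = ν.map logC := by
  have : IsProbabilityMeasure (volume.restrict (Ioo (0 : ℝ) 1)) := ⟨by simp⟩
  have := Measure.isProbabilityMeasure_map (μ := volume.restrict (Ioo (0 : ℝ) 1))
    (measurable_quantile ν).aemeasurable
  have := Measure.isProbabilityMeasure_map (μ := ν) measurable_logC.aemeasurable
  refine Measure.ext_of_Ici _ _ fun x => ?_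
  rw [← compl_Iio, prob_compl_eq_one_sub measurableSet_Iio, prob_compl_eq_one_sub measurableSet_Iio]
  congr 1
  rw [Measure.map_apply (measurable_quantile ν) measurableSet_Iio,
    Measure.map_apply measurable_logC measurableSet_Iio,
    Measure.restrict_apply (measurable_quantile ν measurableSet_Iio)]
  change volume ({u | quantile (periodicCdf ν) u < x} ∩ Ioo 0 1) = ν {z | logC z < x}
  rcases le_or_gt x 0 with hx | hx
  · have h1 : {z | logC z < x} = ∅ := by
      ext z; simpa using hx.trans (logC_mem z).1
    have h2 : {u | quantile (periodicCdf ν) u < x} ∩ Ioo 0 1 = ∅ := by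
      ext u
      simp only [mem_inter_iff, mem_ofPred_eq, mem_Ioo, mem_empty_iff_false, iff_false,
        quantile_lt_iff]
      rintro ⟨⟨y, hy, hu⟩, h0, -⟩
      have := periodicCdf_mono ν (hy.le.trans hx)
      rw [periodicCdf_zero] at this
      linarith
    rw [h1, h2]; simp
  rcases lt_or_ge (2 * π) x with hx2 | hx2
  · have h1 : {z | logC z < x} = univ := by
      ext z; simpa using (logC_mem z).2.trans hx2
    have h2 : {u | quantile (periodicCdf ν) u < x} ∩ Ioo 0 1 = Ioo 0 1 := by
      refine inter_eq_right.2 fun u hu => (quantile_lt_iff ν u x).2 ⟨2 * π, hx2, ?_⟩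
      rw [periodicCdf_two_pi]; exact hu.2.le
    rw [h1, h2]; simp
  have hF := periodicCdf_of_mem_Icc ν ⟨hx.le, hx2⟩
  have h1 : ν.real {z | logC z < x} ≤ 1 := measureReal_le_one
  rw [← ofReal_measureReal (μ := ν)]
  refine le_antisymm ?_ ?_
  · refine (measure_mono (t := Ioc 0 (ν.real {z | logC z < x})) ?_).trans (by simp)
    rintro u ⟨hu, h0, -⟩
    obtain ⟨y, hy, hu⟩ := (quantile_lt_iff ν u x).1 hu
    exact ⟨h0, hF ▸ hu.trans (periodicCdf_mono ν hy.le)⟩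
  · refine le_trans (by simp) (measure_mono (s := Ioo 0 (ν.real {z | logC z < x})) ?_)
    rintro u ⟨h0, hu⟩
    exact ⟨(quantile_lt_iff ν u x).2 (exists_lt_le_periodicCdf ν ⟨hx, hx2⟩ hu), h0, hu.trans_le h1⟩

/-- The quantile gains 2π when its argument gains 1, so its projection to the circle is 1-periodic.
The integral of a periodic function over a period does not see the translation by `θ`. -/
lemma map_expC_quantile_sub (ν : Measure Circle) [IsProbabilityMeasure ν] (θ : ℝ) :
    (volume.restrict (Ioo (0 : ℝ) 1)).map (fun u => expC (quantile (periodicCdf ν) (u - θ))) = ν := by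
  have hm (θ : ℝ) : Measurable fun u => expC (quantile (periodicCdf ν) (u - θ)) :=
    measurable_expC.comp ((measurable_quantile ν).comp (measurable_id.sub_const θ))
  have h0 : (volume.restrict (Ioo (0 : ℝ) 1)).map
      (fun u => expC (quantile (periodicCdf ν) (u - 0))) = ν := by
    have h := congrArg (Measure.map expC) (map_quantile ν)
    rw [Measure.map_map measurable_expC (measurable_quantile ν),
      Measure.map_map measurable_expC measurable_logC] at h
    simp only [sub_zero]
    refine h.trans ?_
    rw [show expC ∘ logC = id from funext expC_logC, Measure.map_id]
  conv_rhs => rw [← h0]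
  ext s hs
  rw [Measure.map_apply (hm θ) hs, Measure.map_apply (hm 0) hs]
  set g : ℝ → ℝ := fun u => s.indicator 1 (expC (quantile (periodicCdf ν) u)) with hg
  have hgp : Function.Periodic g 1 := by
    intro u
    have : expC (quantile (periodicCdf ν) (u + 1)) = expC (quantile (periodicCdf ν) u) := by
      rw [quantile_add_one, expC_periodic]
    simp only [hg, this]
  have key (θ : ℝ) : (volume.restrict (Ioo (0 : ℝ) 1)).real
      ((fun u => expC (quantile (periodicCdf ν) (u - θ))) ⁻¹' s) = ∫ u in (0 : ℝ)..1, g (u - θ) := by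
    rw [intervalIntegral.integral_of_le zero_le_one, integral_Ioc_eq_integral_Ioo,
      ← integral_indicator_one (hm θ hs)]
    rfl
  have h1 : ∫ u in (0 : ℝ)..1, g (u - θ) = ∫ u in (0 : ℝ)..1, g (u - 0) := by
    rw [intervalIntegral.integral_comp_sub_right, intervalIntegral.integral_comp_sub_right]
    have := hgp.intervalIntegral_add_eq (0 - θ) (0 - 0)
    rwa [show (0 : ℝ) - θ + 1 = 1 - θ by ring, show (0 : ℝ) - 0 + 1 = 1 - 0 by ring] at this
  rw [← key, ← key] at h1
  exact (measureReal_eq_measureReal_iff).1 h1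

/-! ### Atomless measures -/

/-- A fibre of the covering map meets `[0, 2π)` in at most one point. -/
lemma nullSingletonClass_of_absolutelyContinuous {μ : Measure Circle} (hμ : μ ≪ arcMeasure) :
    NullSingletonClass μ := by
  refine ⟨fun w => hμ ?_⟩
  unfold arcMeasure
  rw [Measure.map_apply measurable_expC (measurableSet_singleton w),
    Measure.restrict_apply (measurable_expC (measurableSet_singleton w))]
  refine Set.Subsingleton.measure_zero ?_ _
  rintro x ⟨hx, hx'⟩ y ⟨hy, hy'⟩
  exact Circle.exp_injOn_Ico (by simp) hx' hy' (hx.trans (Eq.symm hy))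

section NoAtoms

variable (μ : Measure Circle) [IsProbabilityMeasure μ] [NullSingletonClass μ]

lemma continuous_periodicCdf : Continuous (periodicCdf μ) := by
  have hprob := Measure.isProbabilityMeasure_map (μ := μ) measurable_logC.aemeasurable
  have hsing (x : ℝ) : (μ.map logC) {x} = 0 := by
    rw [Measure.map_apply measurable_logC (measurableSet_singleton x)]
    refine measure_mono_null (t := {expC x}) ?_ (measure_singleton _)
    rintro z rfl
    exact (expC_logC z).symm
  have hcdf : Continuous (ProbabilityTheory.cdf (μ.map logC)) := by
    rw [continuous_iff_continuousAt]
    intro x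
    rw [(ProbabilityTheory.monotone_cdf _).continuousAt_iff_leftLim_eq_rightLim,
      StieltjesFunction.rightLim_eq]
    have h := hsing x
    rw [← ProbabilityTheory.measure_cdf (μ.map logC), StieltjesFunction.measure_singleton,
      ENNReal.ofReal_eq_zero] at h
    exact le_antisymm ((ProbabilityTheory.monotone_cdf _).leftLim_le le_rfl) (by linarith)
  have hG (x : ℝ) : μ.real {z | logC z < x} = ProbabilityTheory.cdf (μ.map logC) x := by
    rw [ProbabilityTheory.cdf_eq_real, measureReal_def, measureReal_def,
      ← measure_congr (Iio_ae_eq_Iic' (hsing x)), Measure.map_apply measurable_logC measurableSet_Iio]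
    rfl
  -- Subtracting the linear part makes the values at 0 and 1 agree, so composing with the fractional
  -- part stays continuous across the period boundary.
  set h : ℝ → ℝ := fun t => μ.real {z | logC z < 2 * π * t} - t with hh
  have hc : Continuous h := by
    simp only [hh, hG]
    exact (hcdf.comp (continuous_const.mul continuous_id)).sub continuous_id
  have hp : 0 < 2 * π := Real.two_pi_pos
  have h01 : h 0 = h 1 := by
    have e0 := periodicCdf_of_mem_Icc μ (x := 0) ⟨le_rfl, hp.le⟩
    have e1 := periodicCdf_of_mem_Icc μ (x := 2 * π) ⟨hp.le, le_rfl⟩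
    rw [periodicCdf_zero] at e0
    rw [periodicCdf_two_pi] at e1
    simp only [hh, mul_zero, mul_one, ← e0, ← e1]
    norm_num
  have hfr := ContinuousOn.comp_fract'' (f := h) hc.continuousOn h01
  have : periodicCdf μ = fun x => (h ∘ Int.fract) (x / (2 * π)) + x / (2 * π) := by
    ext x
    have e : 2 * π * Int.fract (x / (2 * π)) = x - 2 * π * ⌊x / (2 * π)⌋ := by
      rw [Int.fract]; field_simp
    simp only [Function.comp, hh, periodicCdf, e]
    rw [Int.fract]; ring
  rw [this]
  exact (hfr.comp (continuous_id.div_const _)).add (continuous_id.div_const _)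

lemma periodicCdf_quantile (u : ℝ) : periodicCdf μ (quantile (periodicCdf μ) u) = u := by
  have hc := continuous_periodicCdf μ
  refine le_antisymm ?_ ?_
  · by_contra! h
    have h1 : ∀ᶠ y in 𝓝[<] (quantile (periodicCdf μ) u), u < periodicCdf μ y :=
      ((tendsto_order.1 (hc.tendsto _)).1 _ h).filter_mono nhdsWithin_le_nhds
    obtain ⟨y, hy, hyu⟩ := (h1.and self_mem_nhdsWithin).exists
    exact absurd ((quantile_lt_iff μ u _).2 ⟨y, hyu, hy.le⟩) (lt_irrefl _)
  · have h : ∀ᶠ x in 𝓝[>] (quantile (periodicCdf μ) u), u ≤ periodicCdf μ x := by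
      filter_upwards [self_mem_nhdsWithin] with x hx
      obtain ⟨y, hy, hu⟩ := (quantile_lt_iff μ u x).1 hx
      exact hu.trans (periodicCdf_mono μ hy.le)
    exact ge_of_tendsto (hc.continuousWithinAt (s := Ioi _)) h

lemma map_periodicCdf_logC :
    μ.map (fun z => periodicCdf μ (logC z)) = volume.restrict (Ioo (0 : ℝ) 1) := by
  have hm := (periodicCdf_mono μ).measurable
  change μ.map (periodicCdf μ ∘ logC) = _
  rw [← Measure.map_map hm measurable_logC, ← map_quantile,
    Measure.map_map hm (measurable_quantile μ),
    show periodicCdf μ ∘ quantile (periodicCdf μ) = id from funext (periodicCdf_quantile μ),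
    Measure.map_id]

end NoAtoms

lemma apply_eq_of_expC_eq {g : ℝ → ℝ} (hg : Function.Periodic g (2 * π)) {x y : ℝ}
    (h : expC x = expC y) : g x = g y := by
  obtain ⟨m, rfl⟩ := Circle.exp_eq_exp.1 h
  exact hg.int_mul m y

/-! ### Kantorovich potentials of an equivariant monotone map -/

/-- The Kantorovich potential on the line whose optimal transport map is `S`. -/
noncomputable def potential (S : ℝ → ℝ) (x : ℝ) : ℝ := ∫ s in (0 : ℝ)..x, (s - S s)

/-- The conjugate of `potential S` for the cost `(x - y)² / 2`. -/
noncomputable def dualPotential (S : ℝ → ℝ) (y : ℝ) : ℝ := ⨅ x, ((x - y) ^ 2 / 2 - potential S x)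

section Potential

variable {S : ℝ → ℝ} (hS : Monotone S) (hp : ∀ x, S (x + 2 * π) = S x + 2 * π)
  (h0 : ∫ s in (0 : ℝ)..2 * π, (s - S s) = 0)

include hS in
lemma intervalIntegrable_id_sub (a b : ℝ) :
    IntervalIntegrable (fun s => s - S s) volume a b :=
  intervalIntegral.intervalIntegrable_id.sub hS.intervalIntegrable

include hS in
lemma continuous_potential : Continuous (potential S) :=
  intervalIntegral.continuous_primitive (intervalIntegrable_id_sub hS) 0

include hS in
lemma potential_sub (x x' : ℝ) :
    potential S x' - potential S x = ∫ s in x..x', (s - S s) :=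
  intervalIntegral.integral_interval_sub_left (intervalIntegrable_id_sub hS _ _)
    (intervalIntegrable_id_sub hS _ _)

include hS hp h0 in
-- The integrand `s - S s` is periodic, so the increment of the potential over any period is its
-- mean, which `h0` sets to zero.
lemma potential_periodic : Function.Periodic (potential S) (2 * π) := by
  intro x
  have hper : Function.Periodic (fun s => s - S s) (2 * π) := fun s => by
    simp only [hp]; ring
  have h := potential_sub hS x (x + 2 * π)
  rw [hper.intervalIntegral_add_eq x 0, zero_add, h0] at h
  linarith

include hS hp h0 in
lemma exists_abs_potential_le : ∃ C, ∀ x, |potential S x| ≤ C := by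
  obtain ⟨C, hC⟩ := (isCompact_Icc (a := (0 : ℝ)) (b := 2 * π)).exists_bound_of_continuousOn
    (continuous_potential hS).continuousOn
  refine ⟨C, fun x => ?_⟩
  obtain ⟨y, hy, hxy⟩ := (potential_periodic hS hp h0).exists_mem_Ico₀ Real.two_pi_pos x
  rw [hxy]
  exact hC y ⟨hy.1, hy.2.le⟩

include hS hp h0 in
lemma bddBelow_sub_potential (y : ℝ) :
    BddBelow (range fun x => (x - y) ^ 2 / 2 - potential S x) := by
  obtain ⟨C, hC⟩ := exists_abs_potential_le hS hp h0
  refine ⟨-C, ?_⟩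
  rintro _ ⟨x, rfl⟩
  have := (abs_le.1 (hC x)).2
  have := sq_nonneg (x - y)
  simp only
  linarith

include hS hp h0 in
lemma potential_add_dualPotential_le (x y : ℝ) :
    potential S x + dualPotential S y ≤ (x - y) ^ 2 / 2 := by
  have := ciInf_le (bddBelow_sub_potential hS hp h0 y) x
  unfold dualPotential
  linarith

include hS hp h0 in
lemma dualPotential_periodic : Function.Periodic (dualPotential S) (2 * π) := by
  intro y
  unfold dualPotential
  refine (Equiv.iInf_congr (Equiv.addRight (2 * π)) fun x => ?_).symm
  simp only [Equiv.coe_addRight, potential_periodic hS hp h0 x]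
  ring

include hS hp h0 in
-- In the infimum at `y'` a near-minimiser can be moved by multiples of 2π to within π of `y'`,
-- without changing the potential or raising the cost. Testing the infimum at `y` with that point
-- bounds the difference.
lemma dualPotential_sub_le {y y' : ℝ} (h : |y - y'| ≤ π) :
    dualPotential S y - dualPotential S y' ≤ 2 * π * |y - y'| := by
  refine le_of_forall_pos_le_add fun ε hε => ?_
  obtain ⟨x₀, hx₀⟩ := exists_lt_of_ciInf_lt
    (show dualPotential S y' < dualPotential S y' + ε by linarith)
  obtain ⟨x, hx, hxx⟩ : ∃ x, |x - y'| ≤ π ∧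
      (x - y') ^ 2 / 2 - potential S x ≤ (x₀ - y') ^ 2 / 2 - potential S x₀ := by
    obtain ⟨x, hx, hxx⟩ := exists_expC_eq_abs_sub_eq_arcDist y' (expC x₀)
    rw [abs_sub_comm] at hxx
    refine ⟨x, hxx ▸ arcDist_le_pi _ _, ?_⟩
    rw [apply_eq_of_expC_eq (potential_periodic hS hp h0) hx]
    have h1 : (x - y') ^ 2 ≤ (x₀ - y') ^ 2 := by
      rw [sq_le_sq, hxx, abs_sub_comm x₀]
      exact arcDist_expC_le _ _
    linarith
  have h1 := potential_add_dualPotential_le hS hp h0 x y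
  have h2 : (x - y) ^ 2 - (x - y') ^ 2 = (y' - y) * (2 * (x - y') + (y' - y)) := by ring
  -- The second factor is at most `2π + π` in absolute value; `4π` is a convenient upper bound, and
  -- halving it gives the constant `2π`.
  have h3 : (y' - y) * (2 * (x - y') + (y' - y)) ≤ |y - y'| * (4 * π) := by
    refine (le_abs_self _).trans ?_
    rw [abs_mul, abs_sub_comm y' y]
    gcongr
    refine (abs_add_le _ _).trans ?_
    rw [abs_mul, abs_two, abs_sub_comm y' y]
    have := Real.pi_pos
    linarith
  linarith

include hS hp h0 in
-- The function `t ↦ (t - y)² / 2 - potential S t` is a primitive of `S - y`, which is nonpositive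
-- to the left of `x` and nonnegative to the right, so `x` is a global minimiser.
lemma potential_add_dualPotential_eq {x y : ℝ} (hl : ∀ t < x, S t ≤ y) (hr : ∀ t > x, y ≤ S t) :
    potential S x + dualPotential S y = (x - y) ^ 2 / 2 := by
  refine le_antisymm (potential_add_dualPotential_le hS hp h0 x y) ?_
  have h : (x - y) ^ 2 / 2 - potential S x ≤ dualPotential S y := by
    refine le_ciInf fun x' => ?_
    have h1 : ∫ s in x..x', (s - y) = (x' - y) ^ 2 / 2 - (x - y) ^ 2 / 2 := by
      rw [intervalIntegral.integral_comp_sub_right (fun s => s), integral_id]; ring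
    have h2 := potential_sub hS x x'
    have hi : IntervalIntegrable (fun s => s - y) volume x x' :=
      intervalIntegral.intervalIntegrable_id.sub intervalIntegrable_const
    have h3 : ∫ s in x..x', (s - S s) ≤ ∫ s in x..x', (s - y) := by
      rcases le_total x x' with h | h
      · refine intervalIntegral.integral_mono_on_of_le_Ioo h (intervalIntegrable_id_sub hS _ _) hi
          fun s hs => ?_
        have := hr s hs.1
        linarith
      · rw [intervalIntegral.integral_symm, intervalIntegral.integral_symm x' x, neg_le_neg_iff]
        refine intervalIntegral.integral_mono_on_of_le_Ioo h hi.symm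
          (intervalIntegrable_id_sub hS _ _) fun s hs => ?_
        have := hl s hs.2
        linarith
    linarith
  linarith

include hS hp h0 in
-- Contact means that `x` minimises `t ↦ (t - y)² / 2 - potential S t`, and the integral is the
-- increment of this function from `x` to `t`.
lemma integral_sub_nonneg_of_potential_add_eq {x y : ℝ}
    (h : potential S x + dualPotential S y = (x - y) ^ 2 / 2) (t : ℝ) :
    0 ≤ ∫ s in x..t, (S s - y) := by
  have h1 : ∫ s in x..t, (s - y) = (t - y) ^ 2 / 2 - (x - y) ^ 2 / 2 := by
    rw [intervalIntegral.integral_comp_sub_right (fun s => s), integral_id]; ring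
  have h2 := potential_sub hS x t
  have h3 := potential_add_dualPotential_le hS hp h0 t y
  have h4 : ∫ s in x..t, (S s - y) = (∫ s in x..t, (s - y)) - ∫ s in x..t, (s - S s) := by
    rw [← intervalIntegral.integral_sub
      (intervalIntegral.intervalIntegrable_id.sub intervalIntegrable_const)
      (intervalIntegrable_id_sub hS _ _)]
    exact intervalIntegral.integral_congr fun s _ => by ring
  linarith

include hS hp h0 in
-- Otherwise `S - y` would be bounded below by a positive constant on `[t, x]`, and moving from `x`
-- back to `t` would lower the minimum.
lemma le_of_potential_add_eq {x y : ℝ}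
    (h : potential S x + dualPotential S y = (x - y) ^ 2 / 2) {t : ℝ} (ht : t < x) : S t ≤ y := by
  by_contra! hy
  have h1 := integral_sub_nonneg_of_potential_add_eq hS hp h0 h t
  rw [intervalIntegral.integral_symm] at h1
  have h2 : ∫ _ in t..x, (S t - y) ≤ ∫ s in t..x, (S s - y) :=
    intervalIntegral.integral_mono_on ht.le intervalIntegrable_const
      (hS.intervalIntegrable.sub intervalIntegrable_const) fun s hs => by
        have := hS hs.1; linarith
  rw [intervalIntegral.integral_const, smul_eq_mul] at h2
  have := mul_pos (sub_pos.2 ht) (sub_pos.2 hy)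
  linarith

include hS hp h0 in
lemma ge_of_potential_add_eq {x y : ℝ}
    (h : potential S x + dualPotential S y = (x - y) ^ 2 / 2) {t : ℝ} (ht : x < t) : y ≤ S t := by
  by_contra! hy
  have h1 := integral_sub_nonneg_of_potential_add_eq hS hp h0 h t
  have h2 : ∫ s in x..t, (S s - y) ≤ ∫ _ in x..t, (S t - y) :=
    intervalIntegral.integral_mono_on ht.le
      (hS.intervalIntegrable.sub intervalIntegrable_const) intervalIntegrable_const fun s hs => by
        have := hS hs.2; linarith
  rw [intervalIntegral.integral_const, smul_eq_mul] at h2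
  have := mul_pos (sub_pos.2 ht) (sub_pos.2 hy)
  linarith

end Potential

/-! ### One-sided limits of equivariant monotone functions -/

section OneSided

variable {Q : ℝ → ℝ} (hQ : Monotone Q) (hQp : ∀ u, Q (u + 1) = Q u + 2 * π)

include hQ hQp in
lemma rightLim_add_one (u : ℝ) :
    Function.rightLim Q (u + 1) = Function.rightLim Q u + 2 * π := by
  have h : Tendsto (fun v => v + 1) (𝓝[>] u) (𝓝[>] (u + 1)) :=
    tendsto_nhdsWithin_of_tendsto_nhds_of_eventually_within _
      (((continuous_id.add continuous_const).tendsto u).mono_left nhdsWithin_le_nhds)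
      (eventually_mem_nhdsWithin.mono fun v (hv : u < v) => by simpa using hv)
  refine tendsto_nhds_unique ((hQ.tendsto_rightLim (u + 1)).comp h) ?_
  simp only [Function.comp_def, hQp]
  exact (hQ.tendsto_rightLim u).add_const _

include hQ hQp in
lemma leftLim_add_one (u : ℝ) :
    Function.leftLim Q (u + 1) = Function.leftLim Q u + 2 * π := by
  have h : Tendsto (fun v => v + 1) (𝓝[<] u) (𝓝[<] (u + 1)) :=
    tendsto_nhdsWithin_of_tendsto_nhds_of_eventually_within _
      (((continuous_id.add continuous_const).tendsto u).mono_left nhdsWithin_le_nhds)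
      (eventually_mem_nhdsWithin.mono fun v (hv : v < u) => by simpa using hv)
  refine tendsto_nhds_unique ((hQ.tendsto_leftLim (u + 1)).comp h) ?_
  simp only [Function.comp_def, hQp]
  exact (hQ.tendsto_leftLim u).add_const _

variable {F : ℝ → ℝ} (hF : Monotone F)

include hQ hF in
lemma monotone_comp_sub (θ : ℝ) : Monotone fun x => Q (F x - θ) :=
  fun _ _ h => hQ (sub_le_sub_right (hF h) θ)

include hQ hF in
lemma abs_comp_sub_le {θ θ₀ x : ℝ} (hθ : |θ - θ₀| ≤ 1) (hx : x ∈ uIoc 0 (2 * π)) :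
    |Q (F x - θ)| ≤ max |Q (F 0 - θ₀ - 1)| |Q (F (2 * π) - θ₀ + 1)| := by
  rw [uIoc_of_le Real.two_pi_pos.le] at hx
  have h1 := abs_le.1 hθ
  have h2 := hF hx.1.le
  have h3 := hF hx.2
  exact abs_le_max_abs_abs (hQ (by linarith)) (hQ (by linarith))

include hQ hF in
-- As `θ` increases to `θ₀`, the argument `F x - θ` decreases to its limit, hence the right limit of
-- `Q`.
lemma tendsto_integral_comp_sub_left (θ₀ : ℝ) :
    Tendsto (fun θ => ∫ x in (0 : ℝ)..2 * π, Q (F x - θ)) (𝓝[<] θ₀)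
      (𝓝 (∫ x in (0 : ℝ)..2 * π, Function.rightLim Q (F x - θ₀))) := by
  refine intervalIntegral.tendsto_integral_filter_of_dominated_convergence
    (fun _ => max |Q (F 0 - θ₀ - 1)| |Q (F (2 * π) - θ₀ + 1)|)
    (Eventually.of_forall fun θ => (monotone_comp_sub hQ hF θ).measurable.aestronglyMeasurable)
    ?_ intervalIntegrable_const (ae_of_all _ fun x _ => ?_)
  · filter_upwards [Ioo_mem_nhdsLT (show θ₀ - 1 < θ₀ by linarith)] with θ hθ
    refine ae_of_all _ fun x hx => abs_comp_sub_le hQ hF ?_ hx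
    rw [abs_le]; constructor <;> linarith [hθ.1, hθ.2]
  · refine (hQ.tendsto_rightLim _).comp
      (tendsto_nhdsWithin_of_tendsto_nhds_of_eventually_within _
        (((continuous_const.sub continuous_id).tendsto θ₀).mono_left nhdsWithin_le_nhds)
        (eventually_mem_nhdsWithin.mono fun v (hv : v < θ₀) => ?_))
    exact sub_lt_sub_left hv _

include hQ hF in
lemma tendsto_integral_comp_sub_right (θ₀ : ℝ) :
    Tendsto (fun θ => ∫ x in (0 : ℝ)..2 * π, Q (F x - θ)) (𝓝[>] θ₀)
      (𝓝 (∫ x in (0 : ℝ)..2 * π, Function.leftLim Q (F x - θ₀))) := by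
  refine intervalIntegral.tendsto_integral_filter_of_dominated_convergence
    (fun _ => max |Q (F 0 - θ₀ - 1)| |Q (F (2 * π) - θ₀ + 1)|)
    (Eventually.of_forall fun θ => (monotone_comp_sub hQ hF θ).measurable.aestronglyMeasurable)
    ?_ intervalIntegrable_const (ae_of_all _ fun x _ => ?_)
  · filter_upwards [Ioo_mem_nhdsGT (show θ₀ < θ₀ + 1 by linarith)] with θ hθ
    refine ae_of_all _ fun x hx => abs_comp_sub_le hQ hF ?_ hx
    rw [abs_le]; constructor <;> linarith [hθ.1, hθ.2]
  · refine (hQ.tendsto_leftLim _).comp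
      (tendsto_nhdsWithin_of_tendsto_nhds_of_eventually_within _
        (((continuous_const.sub continuous_id).tendsto θ₀).mono_left nhdsWithin_le_nhds)
        (eventually_mem_nhdsWithin.mono fun v (hv : θ₀ < v) => ?_))
    exact sub_lt_sub_left hv _

include hQ hQp hF in
-- The integral of `Q (F - θ)` is nonincreasing in `θ` and drops by `4π²` when `θ` grows by 1, so it
-- crosses every level `c`. It may jump there, since `F` can be constant on an interval where `F -
-- θ` sits at a jump of `Q`; hence only a bracketing by one-sided limits.
lemma exists_integral_leftLim_le_le_integral_rightLim (c : ℝ) :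
    ∃ θ, ∫ x in (0 : ℝ)..2 * π, Function.leftLim Q (F x - θ) ≤ c ∧
      c ≤ ∫ x in (0 : ℝ)..2 * π, Function.rightLim Q (F x - θ) := by
  set g : ℝ → ℝ := fun θ => ∫ x in (0 : ℝ)..2 * π, Q (F x - θ) with hg
  have hi (θ : ℝ) : IntervalIntegrable (fun x => Q (F x - θ)) volume 0 (2 * π) :=
    (monotone_comp_sub hQ hF θ).intervalIntegrable
  have hanti : Antitone g := fun θ θ' h =>
    intervalIntegral.integral_mono_on Real.two_pi_pos.le (hi θ') (hi θ) fun x _ =>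
      hQ (sub_le_sub_left h _)
  have hstep (θ : ℝ) : g (θ + 1) = g θ - 2 * π * (2 * π) := by
    have h (x : ℝ) : Q (F x - (θ + 1)) = Q (F x - θ) - 2 * π := by
      have := hQp (F x - (θ + 1))
      rw [show F x - (θ + 1) + 1 = F x - θ by ring] at this
      linarith
    simp only [hg, h]
    rw [intervalIntegral.integral_sub (hi θ) intervalIntegrable_const,
      intervalIntegral.integral_const, smul_eq_mul, sub_zero]
  have hnat (n : ℕ) : g n = g 0 - n * (2 * π * (2 * π)) ∧ g (-n) = g 0 + n * (2 * π * (2 * π)) := by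
    induction n with
    | zero => simp
    | succ n ih =>
      have h1 := hstep n
      have h2 := hstep (-(n + 1))
      rw [show -((n : ℝ) + 1) + 1 = -n by ring] at h2
      push_cast
      constructor <;> linarith [ih.1, ih.2]
  obtain ⟨n, hn⟩ := exists_nat_gt (|g 0 - c| / (2 * π * (2 * π)))
  rw [div_lt_iff₀ (by positivity)] at hn
  have habs := abs_le.1 (le_refl |g 0 - c|)
  set A := {θ | c ≤ g θ} with hA
  have hne : A.Nonempty := ⟨-n, by simp only [hA, mem_ofPred_eq]; linarith [(hnat n).2]⟩
  have hbd : BddAbove A := by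
    refine ⟨n, fun θ hθ => ?_⟩
    by_contra! h
    have h1 := hanti h.le
    simp only [hA, mem_ofPred_eq] at hθ
    linarith [(hnat n).1]
  refine ⟨sSup A, le_of_tendsto (tendsto_integral_comp_sub_right hQ hF _) ?_,
    ge_of_tendsto (tendsto_integral_comp_sub_left hQ hF _) ?_⟩
  · filter_upwards [self_mem_nhdsWithin] with θ hθ
    by_contra! h
    exact absurd (le_csSup hbd (show θ ∈ A from h.le)) (not_le.2 hθ)
  · filter_upwards [self_mem_nhdsWithin] with θ hθ
    obtain ⟨θ', hθ', hlt⟩ := exists_lt_of_lt_csSup hne hθ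
    exact le_trans hθ' (hanti hlt.le)

end OneSided

/-! ### Dual certificates -/

/-- The monotone map `(F_ν + θ)⁻ ∘ F_μ` on the real line. -/
noncomputable def shiftMap (μ ν : Measure Circle) (θ : ℝ) (x : ℝ) : ℝ :=
  quantile (shiftedCdf θ ν) (periodicCdf μ x)

/-- `f`, `k` are Kantorovich potentials on the circle which certify that the lifted map `S`
transports `μ` optimally, and that it is the only such map. -/
structure IsDualPair (μ : Measure Circle) (S : ℝ → ℝ) (f k : Circle → ℝ) : Prop where
  measurable_left : Measurable f
  bounded_left : ∃ C, ∀ z, |f z| ≤ C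
  lipschitz_right : ∀ w w', k w - k w' ≤ 2 * π * arcDist w w'
  add_le : ∀ x y : ℝ, f (expC x) + k (expC y) ≤ (x - y) ^ 2 / 2
  add_eq : ∀ᵐ z ∂μ, f z + k (expC (S (logC z))) = (logC z - S (logC z)) ^ 2 / 2
  eq_of_add_eq : ∀ᵐ z ∂μ, ∀ y, f z + k (expC y) = (logC z - y) ^ 2 / 2 → y = S (logC z)

/-- The monotone `Q` has countably many discontinuities, and `periodicCdf μ ∘ logC` has uniform law,
which gives countable sets no mass. -/
lemma ae_continuousAt_periodicCdf_sub (μ : Measure Circle) [IsProbabilityMeasure μ]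
    [NullSingletonClass μ] {Q : ℝ → ℝ} (hQ : Monotone Q) (θ : ℝ) :
    ∀ᵐ z ∂μ, ContinuousAt Q (periodicCdf μ (logC z) - θ) := by
  have hm : Measurable fun z => periodicCdf μ (logC z) :=
    (periodicCdf_mono μ).measurable.comp measurable_logC
  have hc : ((fun u => u - θ) ⁻¹' {u | ¬ ContinuousAt Q u}).Countable :=
    hQ.countable_not_continuousAt.preimage (sub_left_injective)
  have h : ∀ᵐ u ∂(μ.map fun z => periodicCdf μ (logC z)),
      u ∉ (fun u => u - θ) ⁻¹' {u | ¬ ContinuousAt Q u} := by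
    rw [map_periodicCdf_logC]
    exact ae_restrict_of_ae (hc.ae_notMem _)
  filter_upwards [ae_of_ae_map hm.aemeasurable h] with z hz
  simpa using hz

/-- The potentials are built from a map `S` interpolating between the one-sided limits of `Q (F -
θ)`. Almost everywhere for `μ` these limits coincide, so `S` may replace the lifted map there. -/
theorem exists_isDualPair (μ ν : Measure Circle) [IsProbabilityMeasure μ]
    [IsProbabilityMeasure ν] [NullSingletonClass μ] :
    ∃ θ f k, IsDualPair μ (shiftMap μ ν θ) f k := by
  have hshift (θ : ℝ) : shiftMap μ ν θ =
      fun x => quantile (periodicCdf ν) (periodicCdf μ x - θ) :=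
    funext fun x => quantile_shiftedCdf θ ν _
  simp only [hshift]
  set Q := quantile (periodicCdf ν)
  set F := periodicCdf μ
  have hQ : Monotone Q := quantile_mono ν
  have hQp : ∀ u, Q (u + 1) = Q u + 2 * π := quantile_add_one ν
  have hF : Monotone F := periodicCdf_mono μ
  have hFc : Continuous F := continuous_periodicCdf μ
  obtain ⟨θ, hl, hr⟩ := exists_integral_leftLim_le_le_integral_rightLim hQ hQp hF
    (∫ s in (0 : ℝ)..2 * π, s)
  -- The weights of the convex combination make the mean of `s - S s` exactly zero, even when the
  -- integral jumps past the required level.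
  obtain ⟨a, b, ha, hb, hab, habc⟩ : _ ∈ segment ℝ _ _ :=
    (segment_eq_Icc (hl.trans hr)).symm ▸ mem_Icc.2 ⟨hl, hr⟩
  set S : ℝ → ℝ := fun x => a * Function.leftLim Q (F x - θ) + b * Function.rightLim Q (F x - θ)
    with hSdef
  have hSl := monotone_comp_sub hQ.leftLim hF θ
  have hSr := monotone_comp_sub hQ.rightLim hF θ
  have hS : Monotone S := (hSl.const_mul ha).add (hSr.const_mul hb)
  have hp : ∀ x, S (x + 2 * π) = S x + 2 * π := by
    intro x
    have h1 : F (x + 2 * π) - θ = (F x - θ) + 1 := by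
      rw [show F (x + 2 * π) = F x + 1 from periodicCdf_add_two_pi μ x]; ring
    simp only [hSdef, h1, leftLim_add_one hQ hQp, rightLim_add_one hQ hQp]
    linear_combination 2 * π * hab
  have h0 : ∫ s in (0 : ℝ)..2 * π, (s - S s) = 0 := by
    rw [intervalIntegral.integral_sub intervalIntegral.intervalIntegrable_id hS.intervalIntegrable,
      intervalIntegral.integral_add (hSl.intervalIntegrable.const_mul a)
        (hSr.intervalIntegrable.const_mul b), intervalIntegral.integral_const_mul,
      intervalIntegral.integral_const_mul, sub_eq_zero]
    exact habc.symm
  have hle (x : ℝ) {v : ℝ} (hv : F x - θ < v) : S x ≤ Q v := by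
    have h1 := hQ.leftLim_le hv.le
    have h2 := hQ.rightLim_le hv
    calc S x ≤ a * Q v + b * Q v := by simp only [hSdef]; gcongr
      _ = Q v := by rw [← add_mul, hab, one_mul]
  have hge (x : ℝ) {v : ℝ} (hv : v < F x - θ) : Q v ≤ S x := by
    have h1 := hQ.le_leftLim hv
    have h2 := hQ.le_rightLim hv.le
    calc Q v = a * Q v + b * Q v := by rw [← add_mul, hab, one_mul]
      _ ≤ S x := by simp only [hSdef]; gcongr
  have hφ := potential_periodic hS hp h0
  have hκ := dualPotential_periodic hS hp h0
  have hφx (x : ℝ) : potential S (logC (expC x)) = potential S x :=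
    apply_eq_of_expC_eq hφ (expC_logC _)
  have hκx (x : ℝ) : dualPotential S (logC (expC x)) = dualPotential S x :=
    apply_eq_of_expC_eq hκ (expC_logC _)
  have hae := ae_continuousAt_periodicCdf_sub μ hQ θ
  refine ⟨θ, fun z => potential S (logC z), fun z => dualPotential S (logC z), ?_, ?_, ?_, ?_, ?_,
    ?_⟩
  · exact (continuous_potential hS).measurable.comp measurable_logC
  · obtain ⟨C, hC⟩ := exists_abs_potential_le hS hp h0
    exact ⟨C, fun z => hC _⟩
  · intro w w'
    obtain ⟨y, hy, hyy⟩ := exists_expC_eq_abs_sub_eq_arcDist (logC w) w'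
    rw [expC_logC] at hyy
    rw [← hyy, apply_eq_of_expC_eq hκ ((expC_logC w').trans hy.symm)]
    exact dualPotential_sub_le hS hp h0 (hyy ▸ arcDist_le_pi _ _)
  · intro x y
    rw [hφx, hκx]
    exact potential_add_dualPotential_le hS hp h0 x y
  · filter_upwards [hae] with z hz
    rw [hκx]
    have hlr := hQ.continuousAt_iff_leftLim_eq_rightLim.1 hz
    have hleft : Function.leftLim Q (F (logC z) - θ) = Q (F (logC z) - θ) :=
      le_antisymm (hQ.leftLim_le le_rfl) (hlr ▸ hQ.le_rightLim le_rfl)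
    have hSz : S (logC z) = Q (F (logC z) - θ) := by
      simp only [hSdef]
      rw [← hlr, hleft, ← add_mul, hab, one_mul]
    exact potential_add_dualPotential_eq hS hp h0 (fun t ht => hSz ▸ hS ht.le)
      (fun t ht => hSz ▸ hS (le_of_lt ht))
  · filter_upwards [hae] with z hz y hy
    rw [hκx] at hy
    have hFz : ContinuousAt (fun t => F t - θ) (logC z) :=
      (hFc.sub continuous_const).continuousAt
    refine le_antisymm ?_ ?_
    -- Contact gives `y ≤ S t` for all `t` to the right, and `S t ≤ Q v` as soon as `F t - θ < v`.
    -- By continuity of `F` such `t` exist for every `v` above `F (logC z) - θ`; letting `v`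
    -- decrease uses continuity of `Q` there. The other inequality is symmetric.
    · have hlim : Tendsto Q (𝓝[>] (F (logC z) - θ)) (𝓝 (Q (F (logC z) - θ))) :=
        hz.tendsto.mono_left nhdsWithin_le_nhds
      refine ge_of_tendsto hlim ?_
      filter_upwards [self_mem_nhdsWithin] with v hv
      have hv' : ∀ᶠ t in 𝓝[>] (logC z), F t - θ < v :=
        ((tendsto_order.1 hFz).2 v hv).filter_mono nhdsWithin_le_nhds
      obtain ⟨t, ht, htz⟩ := (hv'.and self_mem_nhdsWithin).exists
      exact (ge_of_potential_add_eq hS hp h0 hy htz).trans (hle t ht)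
    · have hlim : Tendsto Q (𝓝[<] (F (logC z) - θ)) (𝓝 (Q (F (logC z) - θ))) :=
        hz.tendsto.mono_left nhdsWithin_le_nhds
      refine le_of_tendsto hlim ?_
      filter_upwards [self_mem_nhdsWithin] with v hv
      have hv' : ∀ᶠ t in 𝓝[<] (logC z), v < F t - θ :=
        ((tendsto_order.1 hFz).1 v hv).filter_mono nhdsWithin_le_nhds
      obtain ⟨t, ht, htz⟩ := (hv'.and self_mem_nhdsWithin).exists
      exact (hge t ht).trans (le_of_potential_add_eq hS hp h0 hy htz)

/-! ### Bounds on the transport cost -/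

lemma integrable_of_abs_le {α : Type*} [MeasurableSpace α] {ρ : Measure α} [IsFiniteMeasure ρ]
    {g : α → ℝ} (hg : AEStronglyMeasurable g ρ) {C : ℝ} (hC : ∀ a, |g a| ≤ C) : Integrable g ρ :=
  Integrable.of_bound hg C (ae_of_all _ hC)

lemma arcDist_sq_le (z w : Circle) : |arcDist z w ^ 2| ≤ π ^ 2 := by
  rw [abs_of_nonneg (sq_nonneg _)]
  exact pow_le_pow_left₀ (arcDist_nonneg z w) (arcDist_le_pi z w) 2

lemma isProbabilityMeasure_of_mem_couplings {μ ν : Measure Circle} [IsProbabilityMeasure μ]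
    {γ : Measure (Circle × Circle)} (hγ : γ ∈ couplings μ ν) : IsProbabilityMeasure γ := by
  have : IsProbabilityMeasure (γ.map Prod.fst) := hγ.1 ▸ inferInstance
  exact Measure.isProbabilityMeasure_of_map Prod.fst

lemma le_transportCost {μ ν : Measure Circle} [IsProbabilityMeasure μ] {c : ℝ}
    (h : ∀ γ ∈ couplings μ ν, IsProbabilityMeasure γ → c ≤ ∫ p, arcDist p.1 p.2 ^ 2 ∂γ) :
    ENNReal.ofReal c ≤ transportCost μ ν := by
  refine le_iInf₂ fun γ hγ => ?_
  have := isProbabilityMeasure_of_mem_couplings hγ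
  rw [← ofReal_integral_eq_lintegral_ofReal
    (integrable_of_abs_le (measurable_arcDist.pow_const 2).aestronglyMeasurable
      fun p => arcDist_sq_le p.1 p.2) (ae_of_all _ fun p => sq_nonneg _)]
  exact ENNReal.ofReal_le_ofReal (h γ hγ this)

lemma transportCost_map_le {μ : Measure Circle} {T₁ T₂ : Circle → Circle}
    (h₁ : AEMeasurable T₁ μ) (h₂ : AEMeasurable T₂ μ) :
    transportCost (μ.map T₁) (μ.map T₂) ≤
      ∫⁻ z, ENNReal.ofReal (arcDist (T₁ z) (T₂ z) ^ 2) ∂μ := by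
  have hγ : μ.map (fun z => (T₁ z, T₂ z)) ∈ couplings (μ.map T₁) (μ.map T₂) :=
    ⟨AEMeasurable.map_map_of_aemeasurable measurable_fst.aemeasurable (h₁.prodMk h₂),
      AEMeasurable.map_map_of_aemeasurable measurable_snd.aemeasurable (h₁.prodMk h₂)⟩
  refine (iInf₂_le _ hγ).trans ?_
  rw [lintegral_map' (measurable_arcDist.pow_const 2).ennreal_ofReal.aemeasurable (h₁.prodMk h₂)]

lemma lintegral_arcDist_eq {μ : Measure Circle} [IsProbabilityMeasure μ] {T₁ T₂ : Circle → Circle}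
    (h₁ : AEMeasurable T₁ μ) (h₂ : AEMeasurable T₂ μ) :
    ∫⁻ z, ENNReal.ofReal (arcDist (T₁ z) (T₂ z) ^ 2) ∂μ =
      ENNReal.ofReal (∫ z, arcDist (T₁ z) (T₂ z) ^ 2 ∂μ) :=
  (ofReal_integral_eq_lintegral_ofReal
    (integrable_of_abs_le ((measurable_arcDist.pow_const 2).comp_aemeasurable
      (h₁.prodMk h₂)).aestronglyMeasurable fun _ => arcDist_sq_le _ _)
    (ae_of_all _ fun _ => sq_nonneg _)).symm

lemma W2_sq_le_of_map_eq {μ : Measure Circle} [IsProbabilityMeasure μ] {T₁ T₂ : Circle → Circle}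
    (h₁ : AEMeasurable T₁ μ) (h₂ : AEMeasurable T₂ μ) {ν₁ ν₂ : W2Circle}
    (e₁ : μ.map T₁ = ν₁.measure) (e₂ : μ.map T₂ = ν₂.measure) :
    W2 ν₁ ν₂ ^ 2 ≤ ∫ z, arcDist (T₁ z) (T₂ z) ^ 2 ∂μ := by
  have h := transportCost_map_le h₁ h₂
  rw [lintegral_arcDist_eq h₁ h₂, e₁, e₂] at h
  rw [W2, Real.sq_sqrt ENNReal.toReal_nonneg]
  exact ENNReal.toReal_le_of_le_ofReal (integral_nonneg fun _ => sq_nonneg _) h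

lemma transportCost_ne_top (μ ν : Measure Circle) [IsProbabilityMeasure μ]
    [IsProbabilityMeasure ν] : transportCost μ ν ≠ ∞ := by
  have hγ : μ.prod ν ∈ couplings μ ν :=
    ⟨by rw [Measure.map_fst_prod, measure_univ, one_smul],
      by rw [Measure.map_snd_prod, measure_univ, one_smul]⟩
  have h : ∫⁻ p, ENNReal.ofReal (arcDist p.1 p.2 ^ 2) ∂(μ.prod ν) ≤ ENNReal.ofReal (π ^ 2) := by
    calc ∫⁻ p, ENNReal.ofReal (arcDist p.1 p.2 ^ 2) ∂(μ.prod ν)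
        ≤ ∫⁻ _, ENNReal.ofReal (π ^ 2) ∂(μ.prod ν) := lintegral_mono fun p =>
          ENNReal.ofReal_le_ofReal ((le_abs_self _).trans (arcDist_sq_le p.1 p.2))
      _ = ENNReal.ofReal (π ^ 2) := by rw [lintegral_const, measure_univ, mul_one]
  exact ne_top_of_le_ne_top ENNReal.ofReal_ne_top ((iInf₂_le _ hγ).trans h)

lemma transportCost_comm (μ ν : Measure Circle) : transportCost μ ν = transportCost ν μ := by
  have key (μ ν : Measure Circle) : transportCost μ ν ≤ transportCost ν μ := by
    refine le_iInf₂ fun γ hγ => ?_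
    have h : γ.map Prod.swap ∈ couplings μ ν := by
      constructor
      · rw [Measure.map_map measurable_fst measurable_swap]; exact hγ.2
      · rw [Measure.map_map measurable_snd measurable_swap]; exact hγ.1
    refine (iInf₂_le _ h).trans ?_
    rw [lintegral_map (measurable_arcDist.pow_const 2).ennreal_ofReal measurable_swap]
    exact lintegral_mono fun p => by simp [arcDist_comm p.2 p.1]
  exact le_antisymm (key μ ν) (key ν μ)

lemma W2_comm (ν₁ ν₂ : W2Circle) : W2 ν₁ ν₂ = W2 ν₂ ν₁ := by
  rw [W2, W2, transportCost_comm]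

/-! ### The lifted maps -/

lemma integral_comp_logC (μ : Measure Circle) [IsProbabilityMeasure μ] {g : ℝ → ℝ} (hg : Measurable g) :
    ∫ u in (0 : ℝ)..1, g (quantile (periodicCdf μ) u) = ∫ z, g (logC z) ∂μ := by
  rw [intervalIntegral.integral_of_le zero_le_one, integral_Ioc_eq_integral_Ioo,
    ← integral_map measurable_logC.aemeasurable hg.aestronglyMeasurable, ← map_quantile,
    integral_map (measurable_quantile μ).aemeasurable hg.aestronglyMeasurable]

section ShiftMap

variable (μ ν : Measure Circle) [IsProbabilityMeasure μ] [IsProbabilityMeasure ν]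

lemma shiftMap_mono (θ : ℝ) : Monotone (shiftMap μ ν θ) :=
  (quantile_shiftedCdf_mono θ ν).comp (periodicCdf_mono μ)

lemma measurable_shiftMap_logC (θ : ℝ) : Measurable fun z => shiftMap μ ν θ (logC z) :=
  (shiftMap_mono μ ν θ).measurable.comp measurable_logC

lemma exists_abs_shiftMap_le (θ : ℝ) : ∃ C, ∀ z, |shiftMap μ ν θ (logC z)| ≤ C :=
  ⟨max |shiftMap μ ν θ 0| |shiftMap μ ν θ (2 * π)|, fun z => abs_le_max_abs_abs
    (shiftMap_mono μ ν θ (logC_mem z).1) (shiftMap_mono μ ν θ (logC_mem z).2.le)⟩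

lemma integrable_logC_sub_shiftMap_sq (θ : ℝ) :
    Integrable (fun z => (logC z - shiftMap μ ν θ (logC z)) ^ 2) μ := by
  obtain ⟨C, hC⟩ := exists_abs_shiftMap_le μ ν θ
  refine integrable_of_abs_le (C := (2 * π + C) ^ 2)
    ((measurable_logC.sub (measurable_shiftMap_logC μ ν θ)).pow_const 2).aestronglyMeasurable
    fun z => ?_
  rw [abs_pow]
  refine pow_le_pow_left₀ (abs_nonneg _) ((abs_sub _ _).trans (add_le_add ?_ (hC z))) 2
  rw [abs_of_nonneg (logC_mem z).1]
  exact (logC_mem z).2.le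

variable [NullSingletonClass μ]

lemma shiftCost_eq_integral (θ : ℝ) :
    shiftCost μ ν θ = ∫ z, (logC z - shiftMap μ ν θ (logC z)) ^ 2 ∂μ := by
  rw [← integral_comp_logC μ (g := fun x => (x - shiftMap μ ν θ x) ^ 2)
    ((measurable_id.sub (shiftMap_mono μ ν θ).measurable).pow_const 2)]
  simp only [shiftCost, shiftMap, periodicCdf_quantile]

lemma map_expC_shiftMap (θ : ℝ) :
    μ.map (fun z => expC (shiftMap μ ν θ (logC z))) = ν := by
  have hm : Measurable fun u => expC (quantile (periodicCdf ν) (u - θ)) :=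
    measurable_expC.comp ((measurable_quantile ν).comp (measurable_id.sub_const θ))
  have hF : Measurable fun z => periodicCdf μ (logC z) :=
    (periodicCdf_mono μ).measurable.comp measurable_logC
  simp only [shiftMap, quantile_shiftedCdf]
  have h := map_expC_quantile_sub ν θ
  rwa [← map_periodicCdf_logC μ, Measure.map_map hm hF] at h

/-- Shifting the window of integration of `Q` exchanges `[1 - θ, 1]` for `[-θ, 0]`, where `Q` is
smaller by 2π. Thus the mean of the lifted map determines `θ`. -/
lemma integral_shiftMap (θ : ℝ) :
    ∫ z, shiftMap μ ν θ (logC z) ∂μ = ∫ z, shiftMap μ ν 0 (logC z) ∂μ - 2 * π * θ := by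
  rw [← integral_comp_logC μ (shiftMap_mono μ ν θ).measurable,
    ← integral_comp_logC μ (shiftMap_mono μ ν 0).measurable]
  simp only [shiftMap, periodicCdf_quantile, quantile_shiftedCdf]
  set Q := quantile (periodicCdf ν) with hQ
  have hi (a b : ℝ) : IntervalIntegrable Q volume a b := (quantile_mono ν).intervalIntegrable
  rw [intervalIntegral.integral_comp_sub_right, intervalIntegral.integral_comp_sub_right]
  have h1 : ∫ u in (1 - θ)..1, Q u = (∫ u in (0 - θ)..0, Q u) + 2 * π * θ := by
    have h := intervalIntegral.integral_comp_add_right (a := 0 - θ) (b := 0) Q 1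
    rw [show 0 - θ + 1 = 1 - θ by ring, zero_add] at h
    rw [← h]
    simp only [hQ, quantile_add_one]
    rw [intervalIntegral.integral_add (hi _ _) intervalIntegrable_const,
      intervalIntegral.integral_const, smul_eq_mul]
    ring
  have h2 := intervalIntegral.integral_add_adjacent_intervals (hi (0 - θ) 0) (hi 0 1)
  have h3 := intervalIntegral.integral_add_adjacent_intervals (hi (0 - θ) (1 - θ)) (hi (1 - θ) 1)
  simp only [sub_zero]
  linarith

end ShiftMap

/-! ### Consequences of a dual certificate -/

namespace IsDualPair

variable {μ : Measure Circle} {S : ℝ → ℝ} {f k : Circle → ℝ}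

lemma continuous_right (h : IsDualPair μ S f k) : Continuous fun y => k (expC y) := by
  refine LipschitzWith.continuous (LipschitzWith.of_le_add_mul (Real.toNNReal (2 * π)) fun x y => ?_)
  have h1 := h.lipschitz_right (expC x) (expC y)
  have h2 := mul_le_mul_of_nonneg_left (arcDist_expC_le x y) Real.two_pi_pos.le
  rw [Real.dist_eq, Real.coe_toNNReal _ Real.two_pi_pos.le]
  linarith

lemma measurable_right (h : IsDualPair μ S f k) : Measurable k := by
  have := h.continuous_right.measurable.comp measurable_logC
  simpa only [Function.comp_def, expC_logC] using this

lemma integrable_left (h : IsDualPair μ S f k) (ρ : Measure Circle) [IsFiniteMeasure ρ] :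
    Integrable f ρ :=
  let ⟨_, hC⟩ := h.bounded_left
  integrable_of_abs_le h.measurable_left.aestronglyMeasurable hC

lemma integrable_right (h : IsDualPair μ S f k) (ρ : Measure Circle) [IsFiniteMeasure ρ] :
    Integrable k ρ := by
  refine integrable_of_abs_le (C := |k 1| + 2 * π * π) h.measurable_right.aestronglyMeasurable
    fun w => ?_
  have h1 := h.lipschitz_right w 1
  have h2 := h.lipschitz_right 1 w
  have h3 (z w : Circle) := mul_le_mul_of_nonneg_left (arcDist_le_pi z w) Real.two_pi_pos.le
  have h4 := abs_le.1 (le_refl |k 1|)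
  rw [abs_le]
  constructor <;> linarith [h3 w 1, h3 1 w]

lemma add_le_arcDist (h : IsDualPair μ S f k) (z w : Circle) :
    f z + k w ≤ arcDist z w ^ 2 / 2 := by
  obtain ⟨y, rfl, hy⟩ := exists_expC_eq_abs_sub_eq_arcDist (logC z) w
  rw [expC_logC] at hy
  have := h.add_le (logC z) y
  rwa [expC_logC, ← sq_abs, hy] at this

lemma integral_add_integral_le (h : IsDualPair μ S f k) [IsProbabilityMeasure μ]
    {ν : Measure Circle} {γ : Measure (Circle × Circle)} (hγ : γ ∈ couplings μ ν) :
    ∫ z, f z ∂μ + ∫ w, k w ∂ν ≤ (∫ p, arcDist p.1 p.2 ^ 2 ∂γ) / 2 := by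
  have := isProbabilityMeasure_of_mem_couplings hγ
  have h1 : IsProbabilityMeasure (γ.map Prod.fst) :=
    Measure.isProbabilityMeasure_map measurable_fst.aemeasurable
  have h2 : IsProbabilityMeasure (γ.map Prod.snd) :=
    Measure.isProbabilityMeasure_map measurable_snd.aemeasurable
  have i1 : Integrable (fun p => f p.1) γ :=
    (h.integrable_left (γ.map Prod.fst)).comp_measurable measurable_fst
  have i2 : Integrable (fun p => k p.2) γ :=
    (h.integrable_right (γ.map Prod.snd)).comp_measurable measurable_snd
  rw [← hγ.1, ← hγ.2, integral_map measurable_fst.aemeasurable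
    h.measurable_left.aestronglyMeasurable, integral_map measurable_snd.aemeasurable
    h.measurable_right.aestronglyMeasurable, ← integral_add i1 i2, ← integral_div]
  exact integral_mono (i1.add i2) ((integrable_of_abs_le
    (measurable_arcDist.pow_const 2).aestronglyMeasurable fun p => arcDist_sq_le p.1 p.2).div_const
      2) fun p => h.add_le_arcDist p.1 p.2

lemma integral_comp_right (h : IsDualPair μ S f k) {ν : Measure Circle} {T : Circle → Circle}
    (hT : Measurable T) (e : μ.map T = ν) : ∫ z, k (T z) ∂μ = ∫ w, k w ∂ν := by
  rw [← e, integral_map hT.aemeasurable h.measurable_right.aestronglyMeasurable]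

lemma integrable_comp_right (h : IsDualPair μ S f k) [IsProbabilityMeasure μ]
    {T : Circle → Circle} (hT : Measurable T) : Integrable (fun z => k (T z)) μ :=
  have := Measure.isProbabilityMeasure_map (μ := μ) hT.aemeasurable
  (h.integrable_right (μ.map T)).comp_measurable hT

lemma defect_nonneg (h : IsDualPair μ S f k) (z : Circle) (y : ℝ) :
    0 ≤ (logC z - y) ^ 2 / 2 - (f z + k (expC y)) := by
  have := h.add_le (logC z) y
  rw [expC_logC] at this
  linarith

/-- The points `S ± 2π` project to the same point of the circle, so the certificate says that
neither is cheaper than `S`; comparing squares gives the bound. -/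
lemma ae_abs_sub_le_pi (h : IsDualPair μ S f k) : ∀ᵐ z ∂μ, |logC z - S (logC z)| ≤ π := by
  filter_upwards [h.add_eq] with z hz
  have h1 := h.defect_nonneg z (S (logC z) + 2 * π)
  have h2 := h.defect_nonneg z (S (logC z) - 2 * π)
  rw [expC_periodic, hz] at h1
  rw [expC_periodic.sub_eq, hz] at h2
  have h3 : 0 ≤ 2 * π * (π - (logC z - S (logC z))) := by linarith
  have h4 : 0 ≤ 2 * π * (π + (logC z - S (logC z))) := by linarith
  rw [mul_nonneg_iff_of_pos_left Real.two_pi_pos] at h3 h4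
  rw [abs_le]
  constructor <;> linarith

lemma integrable_defect [IsProbabilityMeasure μ] (h : IsDualPair μ S f k) (ν' : Measure Circle) [IsProbabilityMeasure ν']
    (θ' : ℝ) :
    Integrable (fun z => (logC z - shiftMap μ ν' θ' (logC z)) ^ 2 / 2 -
      (f z + k (expC (shiftMap μ ν' θ' (logC z))))) μ :=
  ((integrable_logC_sub_shiftMap_sq μ ν' θ').div_const 2).sub ((h.integrable_left μ).add
    (h.integrable_comp_right (measurable_expC.comp (measurable_shiftMap_logC μ ν' θ'))))

section

variable [IsProbabilityMeasure μ] [NullSingletonClass μ] {ν : Measure Circle}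
  [IsProbabilityMeasure ν] {θ : ℝ}

/-- The target `ν'` and the shift are arbitrary: the same identity serves for optimality of `θ`, its
uniqueness, and the comparison of two targets. -/
lemma integral_defect (h : IsDualPair μ S f k) (ν' : Measure Circle) [IsProbabilityMeasure ν']
    (θ' : ℝ) :
    ∫ z, ((logC z - shiftMap μ ν' θ' (logC z)) ^ 2 / 2 -
      (f z + k (expC (shiftMap μ ν' θ' (logC z))))) ∂μ =
      shiftCost μ ν' θ' / 2 - (∫ z, f z ∂μ + ∫ w, k w ∂ν') := by
  have hm : Measurable fun z => expC (shiftMap μ ν' θ' (logC z)) :=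
    measurable_expC.comp (measurable_shiftMap_logC μ ν' θ')
  have i2 : Integrable (fun z => f z + k (expC (shiftMap μ ν' θ' (logC z)))) μ :=
    (h.integrable_left μ).add (h.integrable_comp_right hm)
  rw [integral_sub ((integrable_logC_sub_shiftMap_sq μ ν' θ').div_const 2) i2,
    integral_add (h.integrable_left μ) (h.integrable_comp_right hm), integral_div,
    ← shiftCost_eq_integral, ← h.integral_comp_right hm (map_expC_shiftMap μ ν' θ')]

lemma integral_add_integral_eq (h : IsDualPair μ (shiftMap μ ν θ) f k) :
    ∫ z, f z ∂μ + ∫ w, k w ∂ν = shiftCost μ ν θ / 2 := by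
  have h1 := h.integral_defect ν θ
  rw [integral_eq_zero_of_ae] at h1
  · linarith
  · filter_upwards [h.add_eq] with z hz
    rw [hz, sub_self]; rfl

lemma shiftCost_le (h : IsDualPair μ (shiftMap μ ν θ) f k) (θ' : ℝ) :
    shiftCost μ ν θ ≤ shiftCost μ ν θ' := by
  have h1 := h.integral_defect ν θ'
  have h2 := h.integral_add_integral_eq
  have h3 : 0 ≤ shiftCost μ ν θ' / 2 - (∫ z, f z ∂μ + ∫ w, k w ∂ν) :=
    h1 ▸ integral_nonneg fun z => h.defect_nonneg z _
  linarith

/-- Equal costs make the nonnegative defect vanish almost everywhere, so the two lifted maps agree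
almost everywhere; their means then force equal shifts. -/
lemma eq_of_shiftCost_le (h : IsDualPair μ (shiftMap μ ν θ) f k) {θ' : ℝ}
    (hθ : shiftCost μ ν θ' ≤ shiftCost μ ν θ) : θ' = θ := by
  have h1 := h.integral_defect ν θ'
  rw [h.integral_add_integral_eq, le_antisymm hθ (h.shiftCost_le θ'), sub_self,
    integral_eq_zero_iff_of_nonneg (fun z => h.defect_nonneg z _) (h.integrable_defect ν θ')] at h1
  have h2 : ∫ z, shiftMap μ ν θ' (logC z) ∂μ = ∫ z, shiftMap μ ν θ (logC z) ∂μ := by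
    refine integral_congr_ae ?_
    filter_upwards [h1, h.eq_of_add_eq] with z hz hz'
    exact hz' _ (by simp only [Pi.zero_apply] at hz; linarith)
  rw [integral_shiftMap μ ν θ', integral_shiftMap μ ν θ] at h2
  exact mul_left_cancel₀ Real.two_pi_pos.ne' (by linarith)

lemma optShift_eq (h : IsDualPair μ (shiftMap μ ν θ) f k) : optShift μ ν = θ :=
  h.eq_of_shiftCost_le (Classical.epsilon_spec (p := fun θ => ∀ θ', shiftCost μ ν θ ≤
    shiftCost μ ν θ') ⟨θ, h.shiftCost_le⟩ θ)

/-- A closed chain: the dual bound puts the line cost below the transport cost, which is at most the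
cost of the map on the circle, which is at most its cost on the line. -/
lemma transportCost_eq (h : IsDualPair μ (shiftMap μ ν θ) f k) :
    transportCost μ ν = ENNReal.ofReal (shiftCost μ ν θ) ∧
    ∫⁻ z, ENNReal.ofReal (arcDist z (expC (shiftMap μ ν θ (logC z))) ^ 2) ∂μ =
      transportCost μ ν := by
  have hm := measurable_expC.comp (measurable_shiftMap_logC μ ν θ)
  have h1 : ENNReal.ofReal (shiftCost μ ν θ) ≤ transportCost μ ν :=
    le_transportCost fun γ hγ _ => by
      have := h.integral_add_integral_le hγ
      rw [h.integral_add_integral_eq] at this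
      linarith
  have h2 := transportCost_map_le (μ := μ) aemeasurable_id hm.aemeasurable
  rw [Measure.map_id, show μ.map (expC ∘ fun z => shiftMap μ ν θ (logC z)) = ν from
    map_expC_shiftMap μ ν θ] at h2
  have h3 : ∫⁻ z, ENNReal.ofReal (arcDist z (expC (shiftMap μ ν θ (logC z))) ^ 2) ∂μ ≤
      ENNReal.ofReal (shiftCost μ ν θ) := by
    rw [shiftCost_eq_integral, ofReal_integral_eq_lintegral_ofReal
      (integrable_logC_sub_shiftMap_sq μ ν θ) (ae_of_all _ fun z => sq_nonneg _)]
    refine lintegral_mono fun z => ENNReal.ofReal_le_ofReal ?_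
    refine (pow_le_pow_left₀ (arcDist_nonneg _ _) (arcDist_logC_le z _ _ rfl) 2).trans ?_
    rw [sq_abs]
  exact ⟨le_antisymm (h2.trans h3) h1, le_antisymm (h3.trans h1) h2⟩

lemma isOptimalMap (h : IsDualPair μ (shiftMap μ ν θ) f k) :
    IsOptimalMap μ ν fun z => expC (shiftMap μ ν θ (logC z)) :=
  ⟨measurable_expC.comp (measurable_shiftMap_logC μ ν θ), map_expC_shiftMap μ ν θ,
    h.transportCost_eq.2⟩

/-- Optimal transport maps are unique up to null sets. -/
lemma ae_eq_of_isOptimalMap (h : IsDualPair μ (shiftMap μ ν θ) f k) {T : Circle → Circle}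
    (hT : IsOptimalMap μ ν T) : ∀ᵐ z ∂μ, T z = expC (shiftMap μ ν θ (logC z)) := by
  have hc : ∫ z, arcDist z (T z) ^ 2 ∂μ = shiftCost μ ν θ := by
    have h1 := hT.cost_eq
    have h2 := lintegral_arcDist_eq (μ := μ) aemeasurable_id hT.measurable.aemeasurable
    simp only [id] at h2
    rw [h2, h.transportCost_eq.1] at h1
    refine (ENNReal.ofReal_eq_ofReal_iff (integral_nonneg fun _ => sq_nonneg _) ?_).1 h1
    rw [shiftCost_eq_integral]
    exact integral_nonneg fun _ => sq_nonneg _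
  have i1 : Integrable (fun z => arcDist z (T z) ^ 2) μ :=
    integrable_of_abs_le ((measurable_arcDist.pow_const 2).comp
      (measurable_id.prodMk hT.measurable)).aestronglyMeasurable fun z => arcDist_sq_le _ _
  have i2 : Integrable (fun z => f z + k (T z)) μ :=
    (h.integrable_left μ).add (h.integrable_comp_right hT.measurable)
  have h0 : ∫ z, (arcDist z (T z) ^ 2 / 2 - (f z + k (T z))) ∂μ = 0 := by
    rw [integral_sub (i1.div_const 2) i2, integral_add (h.integrable_left μ)
      (h.integrable_comp_right hT.measurable), integral_div, hc,
      h.integral_comp_right hT.measurable hT.map_eq, h.integral_add_integral_eq, sub_self]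
  rw [integral_eq_zero_iff_of_nonneg (fun z => sub_nonneg.2 (h.add_le_arcDist z _))
    ((i1.div_const 2).sub i2)] at h0
  filter_upwards [h0, h.eq_of_add_eq] with z hz hz'
  -- At the nearest lift of `T z` the arc cost is the line cost, so vanishing of the circle defect
  -- becomes contact on the line.
  obtain ⟨y, hy, hyz⟩ := exists_expC_eq_abs_sub_eq_arcDist (logC z) (T z)
  rw [expC_logC] at hyz
  rw [← hz' y, hy]
  rw [hy, ← sq_abs, hyz]
  simp only [Pi.zero_apply] at hz
  linarith

end

end IsDualPair

/-! ### Stability -/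

/-- Jensen's inequality, in the form of a nonnegative variance. -/
lemma sq_integral_arcDist_le {γ : Measure (Circle × Circle)} [IsProbabilityMeasure γ] :
    (∫ p, arcDist p.1 p.2 ∂γ) ^ 2 ≤ ∫ p, arcDist p.1 p.2 ^ 2 ∂γ := by
  have hL : MemLp (fun p : Circle × Circle => arcDist p.1 p.2) 2 γ :=
    MemLp.of_bound measurable_arcDist.aestronglyMeasurable π (ae_of_all _ fun p => by
      rw [Real.norm_of_nonneg (arcDist_nonneg _ _)]; exact arcDist_le_pi _ _)
  have h := ProbabilityTheory.variance_nonneg (fun p : Circle × Circle => arcDist p.1 p.2) γ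
  rw [ProbabilityTheory.variance_eq_sub hL] at h
  exact sub_nonneg.1 h

/-- The potential `k` is `2π`-Lipschitz for the arc distance, so any coupling bounds the difference
by `2π` times its mean distance, and hence by its root mean square distance. -/
lemma IsDualPair.abs_integral_sub_le {μ : Measure Circle} {S : ℝ → ℝ} {f k : Circle → ℝ}
    (h : IsDualPair μ S f k) (ν₁ ν₂ : W2Circle) :
    |∫ w, k w ∂ν₁.measure - ∫ w, k w ∂ν₂.measure| ≤ 2 * π * W2 ν₁ ν₂ := by
  set Δ := |∫ w, k w ∂ν₁.measure - ∫ w, k w ∂ν₂.measure|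
  have hp := Real.two_pi_pos
  have hle : ENNReal.ofReal ((Δ / (2 * π)) ^ 2) ≤ transportCost ν₁.measure ν₂.measure := by
    refine le_transportCost fun γ hγ _ => le_trans ?_ sq_integral_arcDist_le
    refine pow_le_pow_left₀ (by positivity) ((div_le_iff₀' hp).2 ?_) 2
    have i1 : Integrable (fun p => k p.1) γ :=
      (h.integrable_right (γ.map Prod.fst)).comp_measurable measurable_fst
    have i2 : Integrable (fun p => k p.2) γ :=
      (h.integrable_right (γ.map Prod.snd)).comp_measurable measurable_snd
    have i3 : Integrable (fun p : Circle × Circle => 2 * π * arcDist p.1 p.2) γ :=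
      (integrable_of_abs_le measurable_arcDist.aestronglyMeasurable (C := π) fun p => by
        rw [abs_of_nonneg (arcDist_nonneg _ _)]; exact arcDist_le_pi _ _).const_mul _
    have e : ∫ w, k w ∂ν₁.measure - ∫ w, k w ∂ν₂.measure = ∫ p, (k p.1 - k p.2) ∂γ := by
      rw [integral_sub i1 i2, ← hγ.1, ← hγ.2, integral_map measurable_fst.aemeasurable
        h.measurable_right.aestronglyMeasurable, integral_map measurable_snd.aemeasurable
        h.measurable_right.aestronglyMeasurable]
    rw [← integral_const_mul]
    have hle (p : Circle × Circle) : |k p.1 - k p.2| ≤ 2 * π * arcDist p.1 p.2 := by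
      have := h.lipschitz_right p.2 p.1
      rw [arcDist_comm] at this
      exact abs_le.2 ⟨by linarith, h.lipschitz_right _ _⟩
    have habs : Δ ≤ ∫ p, |k p.1 - k p.2| ∂γ := by
      simp only [Δ, e]
      exact abs_integral_le_integral_abs
    exact habs.trans (integral_mono (i1.sub i2).abs i3 hle)
  rw [ENNReal.ofReal_le_iff_le_toReal (transportCost_ne_top _ _)] at hle
  rw [← div_le_iff₀' hp]
  exact Real.le_sqrt_of_sq_le hle

lemma norm_sub_sq_eq_integral {α : Type*} [MeasurableSpace α] {μ : Measure α} (v w : Lp ℝ 2 μ) :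
    ‖v - w‖ ^ 2 = ∫ z, (v z - w z) ^ 2 ∂μ := by
  rw [← real_inner_self_eq_norm_sq, L2.inner_def]
  refine integral_congr_ae ?_
  filter_upwards [Lp.coeFn_sub v w] with z hz
  rw [hz]
  simp [pow_two]

lemma integrable_sub_sq {α : Type*} [MeasurableSpace α] {μ : Measure α} (v w : Lp ℝ 2 μ) :
    Integrable (fun z => (v z - w z) ^ 2) μ :=
  ((Lp.memLp v).sub (Lp.memLp w)).integrable_sq

/-- A bounded sequence along which a continuous function tends to its value at its unique
zero converges to that zero. -/
lemma tendsto_of_tendsto_zero {g : ℝ → ℝ} (hg : Continuous g) {y₀ a b : ℝ}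
    (hy₀ : ∀ y, g y = 0 → y = y₀) {y : ℕ → ℝ} (hy : ∀ n, y n ∈ Icc a b)
    (h : Tendsto (fun n => g (y n)) atTop (𝓝 0)) : Tendsto y atTop (𝓝 y₀) := by
  refine isCompact_Icc.tendsto_nhds_of_unique_mapClusterPt (Eventually.of_forall hy)
    fun x _ hx => hy₀ x ?_
  exact eq_of_nhds_neBot (NeBot.mono (hx.tendsto_comp hg.continuousAt) (inf_le_inf_left _ h))

lemma aemeasurable_expC_Lp (μ : Measure Circle) (v : Lp ℝ 2 μ) : AEMeasurable (fun z => expC (v z)) μ :=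
  measurable_expC.comp_aemeasurable (Lp.aestronglyMeasurable v).aemeasurable

/-! ### Continuity of the exponential and logarithmic maps -/

section LogMap

variable (μ : Measure Circle) [IsProbabilityMeasure μ]

lemma coeFn_logMap (ν : W2Circle) :
    logMap μ ν =ᵐ[μ] fun z => liftMap μ ν.measure (logC z) :=
  MemLp.coeFn_toLp _

lemma norm_logMap_sub_sq (ν₁ ν₂ : W2Circle) :
    ‖logMap μ ν₁ - logMap μ ν₂‖ ^ 2 =
      ∫ z, (liftMap μ ν₁.measure (logC z) - liftMap μ ν₂.measure (logC z)) ^ 2 ∂μ := by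
  rw [norm_sub_sq_eq_integral]
  refine integral_congr_ae ?_
  filter_upwards [coeFn_logMap μ ν₁, coeFn_logMap μ ν₂] with z h1 h2
  rw [h1, h2]

/-- The plan that couples the two images over the same point of `μ` is admissible, and the covering
map is 1-Lipschitz. -/
lemma W2_expMap_le (v w : Lp ℝ 2 μ) : W2 (expMap μ v) (expMap μ w) ≤ ‖v - w‖ := by
  refine le_of_pow_le_pow_left₀ two_ne_zero (norm_nonneg _) ((W2_sq_le_of_map_eq (aemeasurable_expC_Lp μ v) (aemeasurable_expC_Lp μ w)
    rfl rfl).trans ?_)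
  rw [norm_sub_sq_eq_integral]
  refine integral_mono_of_nonneg (ae_of_all _ fun _ => sq_nonneg _) (integrable_sub_sq v w)
    (ae_of_all _ fun z => ?_)
  simp only
  rw [← sq_abs (_ - _)]
  exact pow_le_pow_left₀ (arcDist_nonneg _ _) (arcDist_expC_le _ _) 2

lemma continuous_expMap : Continuous (expMap μ) := by
  refine continuous_def.2 fun U hU => Metric.isOpen_iff.2 fun v hv => ?_
  obtain ⟨ε, hε, h⟩ := hU _ hv
  refine ⟨ε, hε, fun w hw => h _ ((W2_expMap_le μ w v).trans_lt ?_)⟩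
  rwa [← dist_eq_norm]

variable [NullSingletonClass μ]

lemma exists_isDualPair_liftMap (ν : W2Circle) :
    ∃ f k, IsDualPair μ (shiftMap μ ν.measure (optShift μ ν.measure)) f k := by
  obtain ⟨θ, f, k, h⟩ := exists_isDualPair μ ν.measure
  exact ⟨f, k, h.optShift_eq ▸ h⟩

lemma expMap_logMap (ν : W2Circle) : expMap μ (logMap μ ν) = ν := by
  ext1
  change μ.map (fun z => expC (logMap μ ν z)) = ν.measure
  rw [← map_expC_shiftMap μ ν.measure (optShift μ ν.measure)]
  refine Measure.map_congr ?_
  filter_upwards [coeFn_logMap μ ν] with z hz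
  rw [hz]; rfl

lemma integral_arcDist_le_norm_logMap_sub {ν₁ ν₂ : W2Circle} {T₁ T₂ : Circle → Circle}
    (h₁ : IsOptimalMap μ ν₁.measure T₁) (h₂ : IsOptimalMap μ ν₂.measure T₂) :
    ∫ z, arcDist (T₁ z) (T₂ z) ^ 2 ∂μ ≤ ‖logMap μ ν₁ - logMap μ ν₂‖ ^ 2 := by
  obtain ⟨f₁, k₁, d₁⟩ := exists_isDualPair_liftMap μ ν₁
  obtain ⟨f₂, k₂, d₂⟩ := exists_isDualPair_liftMap μ ν₂
  rw [norm_sub_sq_eq_integral]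
  refine integral_mono_ae (integrable_of_abs_le ((measurable_arcDist.pow_const 2).comp
    (h₁.measurable.prodMk h₂.measurable)).aestronglyMeasurable fun _ => arcDist_sq_le _ _)
    (integrable_sub_sq _ _) ?_
  filter_upwards [d₁.ae_eq_of_isOptimalMap h₁, d₂.ae_eq_of_isOptimalMap h₂, coeFn_logMap μ ν₁,
    coeFn_logMap μ ν₂] with z e₁ e₂ e₃ e₄
  rw [e₁, e₂, e₃, e₄, ← sq_abs (_ - _)]
  exact pow_le_pow_left₀ (arcDist_nonneg _ _) (arcDist_expC_le _ _) 2

/-- The defect of the optimal lifted map to `ν'` in the dual certificate of `ν` is controlled by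
the distance between `ν` and `ν'`. -/
lemma integral_defect_le {ν ν' : W2Circle} {f k f' k' : Circle → ℝ} {θ θ' : ℝ}
    (d : IsDualPair μ (shiftMap μ ν.measure θ) f k)
    (d' : IsDualPair μ (shiftMap μ ν'.measure θ') f' k') :
    ∫ z, ((logC z - shiftMap μ ν'.measure θ' (logC z)) ^ 2 / 2 -
      (f z + k (expC (shiftMap μ ν'.measure θ' (logC z))))) ∂μ ≤ 4 * π * W2 ν ν' := by
  rw [d.integral_defect]
  have h1 := d.integral_add_integral_eq
  have h2 := d'.integral_add_integral_eq
  have h3 : 0 ≤ shiftCost μ ν.measure θ / 2 - (∫ z, f' z ∂μ + ∫ w, k' w ∂ν.measure) :=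
    d'.integral_defect ν.measure θ ▸ integral_nonneg fun z => d'.defect_nonneg z _
  have h4 := abs_le.1 (d.abs_integral_sub_le ν ν')
  have h5 := abs_le.1 (d'.abs_integral_sub_le ν ν')
  -- Half the cost to `ν'` is the dual value of `(f', k')`. Replacing `ν'` by `ν` costs `2π W2`, the
  -- result is at most half the cost to `ν`, which is the dual value of `(f, k)`, and returning to
  -- `ν'` costs another `2π W2`.
  linarith

lemma exists_subseq_tendsto_liftMap {ν : W2Circle} {νs : ℕ → W2Circle}
    (h : Tendsto (fun n => W2 ν (νs n)) atTop (𝓝 0)) :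
    ∃ ms : ℕ → ℕ, StrictMono ms ∧ ∀ᵐ z ∂μ,
      Tendsto (fun n => liftMap μ (νs (ms n)).measure (logC z)) atTop
        (𝓝 (liftMap μ ν.measure (logC z))) := by
  obtain ⟨f, k, d⟩ := exists_isDualPair_liftMap μ ν
  choose fs ks ds using fun n => exists_isDualPair_liftMap μ (νs n)
  set D : ℕ → Circle → ℝ := fun n z => (logC z - liftMap μ (νs n).measure (logC z)) ^ 2 / 2 -
    (f z + k (expC (liftMap μ (νs n).measure (logC z)))) with hD
  have hDint (n : ℕ) : Integrable (D n) μ := d.integrable_defect _ _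
  have hDnn (n : ℕ) (z : Circle) : 0 ≤ D n z := d.defect_nonneg z _
  have hD0 : Tendsto (fun n => eLpNorm (D n - 0) 1 μ) atTop (𝓝 0) := by
    have h1 (n : ℕ) : eLpNorm (D n - 0) 1 μ ≤ ENNReal.ofReal (4 * π * W2 ν (νs n)) := by
      rw [sub_zero, eLpNorm_one_eq_lintegral_enorm, ← ofReal_integral_norm_eq_lintegral_enorm
        (hDint n)]
      refine ENNReal.ofReal_le_ofReal (le_trans (le_of_eq ?_) (integral_defect_le μ d (ds n)))
      exact integral_congr_ae (ae_of_all _ fun z => Real.norm_of_nonneg (hDnn n z))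
    refine tendsto_of_tendsto_of_tendsto_of_le_of_le tendsto_const_nhds ?_ (fun _ => zero_le) h1
    have h2 := ENNReal.tendsto_ofReal (h.const_mul (4 * π))
    rwa [mul_zero, ENNReal.ofReal_zero] at h2
  -- Convergence in L¹ gives convergence in measure, hence almost everywhere only along a
  -- subsequence.
  obtain ⟨ms, hms, hae⟩ := (tendstoInMeasure_of_tendsto_eLpNorm one_ne_zero
    (fun n => (hDint n).aestronglyMeasurable) aestronglyMeasurable_zero hD0).exists_seq_tendsto_ae
  refine ⟨ms, hms, ?_⟩
  filter_upwards [hae, d.eq_of_add_eq, ae_all_iff.2 fun n => (ds n).ae_abs_sub_le_pi]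
    with z h1 h2 h3
  refine tendsto_of_tendsto_zero (a := logC z - π) (b := logC z + π)
    (g := fun y => (logC z - y) ^ 2 / 2 - (f z + k (expC y))) ?_ (fun y hy => h2 y ?_)
    (fun n => ?_) h1
  · exact (((continuous_const.sub continuous_id).pow 2).div_const 2).sub
      (continuous_const.add d.continuous_right)
  · linarith
  · have := abs_le.1 (h3 (ms n))
    constructor
    · linarith! [this.2]
    · linarith! [this.1]

theorem tendsto_norm_logMap_sub {ν : W2Circle} {νs : ℕ → W2Circle}
    (h : Tendsto (fun n => W2 ν (νs n)) atTop (𝓝 0)) :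
    Tendsto (fun n => ‖logMap μ (νs n) - logMap μ ν‖) atTop (𝓝 0) := by
  -- Almost everywhere convergence along a further subsequence of each subsequence is enough,
  -- because the limit is always the same.
  refine tendsto_of_subseq_tendsto fun ns hns => ?_
  obtain ⟨ms, -, hae⟩ := exists_subseq_tendsto_liftMap μ (h.comp hns)
  refine ⟨ms, ?_⟩
  have hsq : Tendsto (fun n => ‖logMap μ (νs (ns (ms n))) - logMap μ ν‖ ^ 2) atTop (𝓝 0) := by
    simp only [norm_logMap_sub_sq]
    rw [← integral_zero Circle ℝ (μ := μ)]
    -- Both lifts lie within π of `logC z` almost everywhere, so they differ by at most `2π`.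
    refine tendsto_integral_of_dominated_convergence (fun _ => (2 * π) ^ 2) (fun n => ?_)
      (integrable_const _) (fun n => ?_) ?_
    · exact (((measurable_liftMap_logC μ _).sub
        (measurable_liftMap_logC μ _)).pow_const 2).aestronglyMeasurable
    · obtain ⟨_, _, d⟩ := exists_isDualPair_liftMap μ ν
      obtain ⟨_, _, d'⟩ := exists_isDualPair_liftMap μ (νs (ns (ms n)))
      filter_upwards [d.ae_abs_sub_le_pi, d'.ae_abs_sub_le_pi] with z h1 h2
      rw [norm_pow]
      refine pow_le_pow_left₀ (norm_nonneg _) ?_ 2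
      rw [abs_le] at h1 h2
      rw [Real.norm_eq_abs, abs_le]
      constructor
      · linarith! [h1.1, h1.2, h2.1, h2.2]
      · linarith! [h1.1, h1.2, h2.1, h2.2]
    · filter_upwards [hae] with z hz
      have := (hz.sub_const (liftMap μ ν.measure (logC z))).pow 2
      simpa using this
  have := hsq.sqrt
  simpa [Real.sqrt_sq] using this

lemma continuous_logMap : Continuous (logMap μ) := by
  refine continuous_def.2 fun U hU ν hν => ?_
  -- Open sets are defined through `W2`-balls, so failure of openness directly yields a sequence
  -- converging to `ν` outside the preimage; no triangle inequality for `W2` is needed.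
  by_contra! hcon
  choose νs hνs hνU using fun n : ℕ => hcon (1 / ((n : ℝ) + 1)) Nat.one_div_pos_of_nat
  have h0 : Tendsto (fun n => W2 ν (νs n)) atTop (𝓝 0) :=
    squeeze_zero (fun _ => Real.sqrt_nonneg _) (fun n => W2_comm ν (νs n) ▸ (hνs n).le)
      tendsto_one_div_add_atTop_nhds_zero_nat
  have h1 := tendsto_iff_norm_sub_tendsto_zero.2 (tendsto_norm_logMap_sub μ h0)
  obtain ⟨n, hn⟩ := (h1.eventually (hU.mem_nhds hν)).exists
  exact hνU n hn

/-- The logarithmic map as a homeomorphism onto its image. -/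
noncomputable def logHomeomorph : W2Circle ≃ₜ range (logMap μ) where
  toFun := rangeFactorization (logMap μ)
  invFun v := expMap μ v
  left_inv ν := expMap_logMap μ ν
  right_inv := by
    rintro ⟨_, ν, rfl⟩
    exact Subtype.ext (congrArg (logMap μ) (expMap_logMap μ ν))
  continuous_toFun := (continuous_logMap μ).subtype_mk _
  continuous_invFun := (continuous_expMap μ).comp continuous_subtype_val

end LogMap

end CircleOT

theorem mainTheorem4 (μ : MeasureTheory.Measure Circle) [MeasureTheory.IsProbabilityMeasure μ]
    (hμ : μ ≪ CircleOT.arcMeasure) :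
    -- `θ*` and the optimal transport maps from `μ` are well defined
    (∀ ν : CircleOT.W2Circle,
      (∃! θ : ℝ, ∀ θ' : ℝ,
        CircleOT.shiftCost μ ν.measure θ ≤ CircleOT.shiftCost μ ν.measure θ') ∧
      CircleOT.IsOptimalMap μ ν.measure
        (fun z => CircleOT.expC (CircleOT.liftMap μ ν.measure (CircleOT.logC z)))) ∧
    -- the two inequalities, and continuity of the exponential map
    (∀ (ν₁ ν₂ : CircleOT.W2Circle) (T₁ T₂ : Circle → Circle),
      CircleOT.IsOptimalMap μ ν₁.measure T₁ → CircleOT.IsOptimalMap μ ν₂.measure T₂ →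
      CircleOT.W2 ν₁ ν₂ ^ 2 ≤ ∫ z, CircleOT.arcDist (T₁ z) (T₂ z) ^ 2 ∂μ ∧
      ∫ z, CircleOT.arcDist (T₁ z) (T₂ z) ^ 2 ∂μ
        ≤ ‖CircleOT.logMap μ ν₁ - CircleOT.logMap μ ν₂‖ ^ 2) ∧
    Continuous (CircleOT.expMap μ) ∧
    -- sequential continuity of the logarithmic map
    (∀ (ν : CircleOT.W2Circle) (νs : ℕ → CircleOT.W2Circle),
      Tendsto (fun n => CircleOT.W2 ν (νs n)) atTop (𝓝 0) →
      Tendsto (fun n => ‖CircleOT.logMap μ (νs n) - CircleOT.logMap μ ν‖) atTop (𝓝 0)) ∧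
    -- homeomorphism onto the image, with the exponential map as inverse
    (∃ h : CircleOT.W2Circle ≃ₜ range (CircleOT.logMap μ),
      (∀ ν, (h ν : MeasureTheory.Lp ℝ 2 μ) = CircleOT.logMap μ ν) ∧
      ∀ v, h.symm v = CircleOT.expMap μ v) := by
  have := CircleOT.nullSingletonClass_of_absolutelyContinuous hμ
  refine ⟨fun ν => ?_, fun ν₁ ν₂ T₁ T₂ h₁ h₂ => ⟨?_, ?_⟩, CircleOT.continuous_expMap μ,
    fun ν νs h => CircleOT.tendsto_norm_logMap_sub μ h,
    CircleOT.logHomeomorph μ, fun _ => rfl, fun _ => rfl⟩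
  · obtain ⟨f, k, d⟩ := CircleOT.exists_isDualPair_liftMap μ ν
    exact ⟨⟨_, d.shiftCost_le, fun θ hθ => d.eq_of_shiftCost_le (hθ _)⟩, d.isOptimalMap⟩
  · exact CircleOT.W2_sq_le_of_map_eq h₁.measurable.aemeasurable h₂.measurable.aemeasurable
      h₁.map_eq h₂.map_eq
  · exact CircleOT.integral_arcDist_le_norm_logMap_sub μ h₁ h₂
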